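/- Let $G$ be a compact connected Lie group, $K\subset G$ a compact connected Lie subgroup, $\mathfrak k\subset\mathfrak g$ their Lie algebras, and $\langle\cdot,\cdot\rangle$ an $\mathrm{Ad}_G$-invariant scalar product on $\mathfrak g$. Let $\mathrm{pr}_{\mathfrak k}:\mathfrak g\to\mathfrak k$ be the orthogonal projection, $\nabla$ the gradient with respect to $\langle\cdot,\cdot\rangle$, $\Lambda_x(a,b)=-\langle x,[a,b]\rangle$, and $\{f,g\}(x)=\Lambda_x(\nabla f(x),\nabla g(x))$ the Lie–Poisson bracket on $\mathfrak g$. Let $\mathbb R[\mathfrak g]$, $\mathbb R[\mathfrak k]$ be the algebras of real polynomial functions, and $\mathbb R[\mathfrak g]^G$, $\mathbb R[\mathfrak g]^K$ the algebras of polynomials on $\mathfrak g$ invariant under $\mathrm{Ad}_G$, $\mathrm{Ad}_K$. "Generic" means "in an open dense subset". For a set $\mathcal F$ of smooth functions on $\mathfrak g$ put $F_x=\mathrm{span}\{\nabla f(x)\mid f\in\mathcal F\}$. The set $\mathcal F$ is *complete* on $\mathfrak g$ if on an open dense set $\dim F_x$ and $\dim\ker(\Lambda_x|_{F_x})$ are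 constant and $\dim F_x+\dim\ker(\Lambda_x|_{F_x})=\dim\mathfrak g+\dim\ker\Lambda_x$. A polynomial $p$ is *independent* from $\mathcal F$ if $\nabla p(x)\notin F_x$ for generic $x\in\mathfrak g$. A set $\mathfrak B\subset\mathbb R[\mathfrak g]^K$ is a *complete commutative set of $\mathrm{ad}_{\mathfrak k}$-invariants* if $\{f,g\}=0$ for all $f,g\in\mathfrak B$ and $\mathrm{span}\,\mathfrak B+\mathrm{pr}_{\mathfrak k}^*\mathbb R[\mathfrak k]$ is complete on $\mathfrak g$. The action of $\mathrm{Ad}_K$ on an adjoint orbit $\mathcal O\subset\mathfrak g$ of $G$ has *complexity* $c$ if $\mathrm{ddim}\,C^\infty_K(\mathcal O)-\mathrm{dind}\,C^\infty_K(\mathcal O)=2c$, where $C^\infty_K(\mathcal O)$ is the algebra of $\mathrm{Ad}_K$-invariant smooth functions on $\mathcal O$, and $\mathrm{ddim}$ and $\mathrm{dind}$ are, at a generic point of $\mathcal O$, the dimension of the span of the differentials of these functions in $T^*\mathcal O$ and the dimension of the kernel of the restriction to that span of the Poisson tensor induced on $\mathcal O$ (a symplectic leaf of $\mathfrak g$).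 The subgroup $K$ is *almost multiplicity free* if $\mathrm{Ad}_K$ has complexity $1$ on a generic adjoint orbit, i.e. on the orbit of a generic $x\in\mathfrak g$. **Proposition 5.1.** Assume that $K$ is an almost multiplicity free subgroup of $G$, and let $p\in\mathbb R[\mathfrak g]^K$ be any polynomial independent from $\mathbb R[\mathfrak g]^G\cup\mathrm{pr}_{\mathfrak k}^*\mathbb R[\mathfrak k]$. Then the algebra of polynomials generated by $\mathbb R[\mathfrak g]^G$ and $p$ is a complete commutative set of $\mathrm{ad}_{\mathfrak k}$-invariants. -/

import Mathlib

open scoped Manifold ContDiff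

noncomputable section

/-! ### Polynomial functions and scalar products on a real vector space -/

/-- The algebra `ℝ[V]` of real polynomial functions on a real vector space `V`: the algebra of
functions on `V` generated by the linear functionals. -/
def polyFun (V : Type*) [AddCommGroup V] [Module ℝ V] : Subalgebra ℝ (V → ℝ) :=
  Algebra.adjoin ℝ (Set.range fun (φ : Module.Dual ℝ V) (v : V) => φ v)

/-- A scalar product (symmetric positive definite bilinear form) on a real vector space. -/
structure ScalarProduct (V : Type*) [AddCommGroup V] [Module ℝ V] where
  /-- the underlying bilinear form -/
  form : LinearMap.BilinForm ℝ V
  symm : ∀ x y, form x y = form y x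
  pos : ∀ x, x ≠ 0 → 0 < form x x

namespace ScalarProduct

section Basic

variable {V : Type*} [AddCommGroup V] [Module ℝ V] (B : ScalarProduct V)

theorem isRefl : B.form.IsRefl := fun x y h => by rw [B.symm]; exact h

theorem eq_zero_of_self {x : V} (h : B.form x x = 0) : x = 0 := by
  by_contra hx
  exact absurd h (B.pos x hx).ne'

theorem nondegenerate : B.form.Nondegenerate :=
  ⟨fun x hx => B.eq_zero_of_self (hx x), fun x hx => B.eq_zero_of_self (hx x)⟩

variable [FiniteDimensional ℝ V]

theorem isCompl_orthogonal (W : Submodule ℝ V) : IsCompl W (B.form.orthogonal W) := by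
  rw [LinearMap.BilinForm.isCompl_orthogonal_iff_disjoint B.isRefl, Submodule.disjoint_def]
  intro x hx hx'
  exact B.eq_zero_of_self (hx' x hx)

/-- The orthogonal projection onto a subspace `W`. -/
def proj (W : Submodule ℝ V) : V →ₗ[ℝ] W :=
  W.projectionOnto (B.form.orthogonal W) (B.isCompl_orthogonal W)

/-- `pr_W^* ℝ[W]`: the polynomial functions on `V` obtained by lifting the polynomial functions
on `W` along the orthogonal projection onto `W`. -/
def liftedPoly (W : Submodule ℝ V) : Submodule ℝ (V → ℝ) :=
  (Subalgebra.toSubmodule (polyFun W)).map (LinearMap.funLeft ℝ ℝ (B.proj W))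

variable [TopologicalSpace V]

/-- The gradient `∇f(x)`, determined by `⟨∇f(x), ξ⟩ = df(x)(ξ)`. -/
def grad (f : V → ℝ) (x : V) : V :=
  (B.form.toDual B.nondegenerate).symm (fderiv ℝ f x : V →ₗ[ℝ] ℝ)

/-- The span of the gradients at `x` of the functions in `F`; under the identification of
`V` with its dual this is the space `F_x` spanned by the differentials `df(x)`, `f ∈ F`. -/
def gradSpan (F : Set (V → ℝ)) (x : V) : Submodule ℝ V :=
  Submodule.span ℝ ((fun f => B.grad f x) '' F)

/-- `p` is (functionally) independent from `F`: at a generic point, the differential of `p` is not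
a linear combination of differentials of members of `F`. -/
def IsIndependentFrom (p : V → ℝ) (F : Set (V → ℝ)) : Prop :=
  ∃ U : Set V, IsOpen U ∧ Dense U ∧ ∀ x ∈ U, B.grad p x ∉ B.gradSpan F x

end Basic

/-! ### The Lie–Poisson structure and complete sets of functions -/

section LiePoisson

variable {L : Type*} [LieRing L] [LieAlgebra ℝ L] (B : ScalarProduct L)

/-- The Lie–Poisson tensor at `x`, as a bilinear form on `L ≅ L^*`:
`Λ_x(a, b) = -⟨x, [a, b]⟩`. -/
def poissonTensor (x : L) : LinearMap.BilinForm ℝ L :=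
  LinearMap.mk₂ ℝ (fun a b => -B.form x ⁅a, b⁆)
    (fun a a' b => by simp [add_comm]) (fun c a b => by simp)
    (fun a b b' => by simp [add_comm]) (fun c a b => by simp)

/-- The kernel of the restriction of `Λ_x` to the subspace `F`. -/
def kerOn (x : L) (F : Submodule ℝ L) : Submodule ℝ L :=
  F ⊓ (B.poissonTensor x).orthogonal F

variable [FiniteDimensional ℝ L] [TopologicalSpace L]

/-- The Lie–Poisson bracket `{f, g}(x) = -⟨x, [∇f(x), ∇g(x)]⟩`. -/
def poissonBracket (f g : L → ℝ) (x : L) : ℝ :=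
  B.poissonTensor x (B.grad f x) (B.grad g x)

/-- `F` is complete on `L` with respect to the Lie–Poisson bracket: on an open dense set the
dimensions of `F_x` and of the kernel of `Λ_x` restricted to `F_x` are constant and
`dim F_x + dim ker (Λ_x|F_x) = dim L + dim ker Λ_x`. -/
def IsComplete (F : Set (L → ℝ)) : Prop :=
  ∃ (U : Set L) (d i : ℕ), IsOpen U ∧ Dense U ∧ ∀ x ∈ U,
    Module.finrank ℝ (B.gradSpan F x) = d ∧
    Module.finrank ℝ (B.kerOn x (B.gradSpan F x)) = i ∧
    d + i = Module.finrank ℝ L + Module.finrank ℝ (B.kerOn x ⊤)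

end LiePoisson

end ScalarProduct

/-! ### Compact Lie groups, their adjoint action and Lie subgroups -/

section LieGroup

variable {E : Type*} [NormedAddCommGroup E] [NormedSpace ℝ E]
  (G : Type*) [TopologicalSpace G] [ChartedSpace E G] [Group G]

instance instFiniteDimensionalGroupLieAlgebra [FiniteDimensional ℝ E] :
    FiniteDimensional ℝ (GroupLieAlgebra 𝓘(ℝ, E) G) :=
  inferInstanceAs (FiniteDimensional ℝ E)

/-- The Lie algebra structure needs the group to be `C^3` only. -/
instance instLieGroupMinSmoothness [LieGroup 𝓘(ℝ, E) ∞ G] :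
    LieGroup 𝓘(ℝ, E) (minSmoothness ℝ 3) G := by
  rw [minSmoothness_of_isRCLikeNormedField]
  infer_instance

variable {G}

/-- The adjoint representation: `Ad g` is the derivative at `1` of the conjugation by `g`. -/
def Ad (g : G) : GroupLieAlgebra 𝓘(ℝ, E) G →L[ℝ] GroupLieAlgebra 𝓘(ℝ, E) G :=
  mfderiv 𝓘(ℝ, E) 𝓘(ℝ, E) (fun h : G => g * h * g⁻¹) 1

/-- The adjoint orbit of `x`. -/
def adOrbit (x : GroupLieAlgebra 𝓘(ℝ, E) G) : Set (GroupLieAlgebra 𝓘(ℝ, E) G) :=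
  Set.range fun g : G => Ad g x

/-- `ℝ[𝔤]^K`: the polynomial functions on the Lie algebra of `G` that are invariant under `Ad k`
for all `k` in the subgroup `K` (for `K = ⊤` this is `ℝ[𝔤]^G`). -/
def invPoly (K : Subgroup G) : Subalgebra ℝ (GroupLieAlgebra 𝓘(ℝ, E) G → ℝ) where
  carrier := {p | p ∈ polyFun (GroupLieAlgebra 𝓘(ℝ, E) G) ∧ ∀ k ∈ K, ∀ x, p (Ad k x) = p x}
  mul_mem' := fun ha hb => ⟨mul_mem ha.1 hb.1, fun k hk x => by
    simp only [Pi.mul_apply, ha.2 k hk x, hb.2 k hk x]⟩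
  add_mem' := fun ha hb => ⟨add_mem ha.1 hb.1, fun k hk x => by
    simp only [Pi.add_apply, ha.2 k hk x, hb.2 k hk x]⟩
  algebraMap_mem' := fun r => ⟨algebraMap_mem _ r, fun _ _ _ => rfl⟩

/-- The Lie algebra `𝔨 ⊆ 𝔤` of a Lie subgroup `K`: the image of the tangent space of `K` at the
identity under the derivative of the inclusion. -/
def subgroupLieAlgebra (F : Type*) [NormedAddCommGroup F] [NormedSpace ℝ F]
    (K : Subgroup G) [ChartedSpace F K] : Submodule ℝ (GroupLieAlgebra 𝓘(ℝ, E) G) :=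
  LinearMap.range
    (mfderiv 𝓘(ℝ, F) 𝓘(ℝ, E) (Subtype.val : K → G) 1 :
      GroupLieAlgebra 𝓘(ℝ, F) K →ₗ[ℝ] GroupLieAlgebra 𝓘(ℝ, E) G)

/-- The smooth functions on an adjoint orbit `O` that are invariant under `Ad K`. As `O` is a
closed embedded submanifold, its smooth functions are the restrictions of the smooth functions
on `𝔤`; a function on `O` is represented here by its smooth extensions to `𝔤`. -/
def orbitInvariants (K : Subgroup G) (O : Set (GroupLieAlgebra 𝓘(ℝ, E) G)) :
    Set (GroupLieAlgebra 𝓘(ℝ, E) G → ℝ) :=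
  {f | ContDiff ℝ ∞ (fun v : E => f v) ∧ ∀ k ∈ K, ∀ y ∈ O, f (Ad k y) = f y}

variable [FiniteDimensional ℝ E] [LieGroup 𝓘(ℝ, E) ∞ G]

/-- The differential at `y` of functions on the adjoint orbit through `y`. The orbit is the
symplectic leaf through `y`: its tangent space is the orthogonal complement of `ker Λ_y`, so its
cotangent space is `𝔤 ⧸ ker Λ_y`, with the symplectic Poisson tensor induced by `Λ_y`. Passing
from a function on `𝔤` to its restriction to the orbit projects its gradient to this quotient. -/
def toOrbitCotangent (B : ScalarProduct (GroupLieAlgebra 𝓘(ℝ, E) G))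
    (y : GroupLieAlgebra 𝓘(ℝ, E) G) :
    GroupLieAlgebra 𝓘(ℝ, E) G →ₗ[ℝ] GroupLieAlgebra 𝓘(ℝ, E) G ⧸ B.kerOn y ⊤ :=
  (B.kerOn y ⊤).mkQ

/-- The action of `Ad K` on the adjoint orbit `O` of `x` has complexity `c`: for the algebra
`C^∞_K(O)` one has `ddim C^∞_K(O) - dind C^∞_K(O) = 2c`, where `ddim` is the dimension of the space
of differentials of its members and `dind` that of the kernel of the Poisson tensor of `O`
restricted to this space, both at a generic point of `O` (i.e. on a relatively open
dense subset of `O`). -/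
def HasComplexity (B : ScalarProduct (GroupLieAlgebra 𝓘(ℝ, E) G)) (K : Subgroup G)
    (x : GroupLieAlgebra 𝓘(ℝ, E) G) (c : ℕ) : Prop :=
  ∃ (V : Set (GroupLieAlgebra 𝓘(ℝ, E) G)) (d i : ℕ),
    IsOpen V ∧ adOrbit x ⊆ closure (V ∩ adOrbit x) ∧ d = i + 2 * c ∧
    ∀ y ∈ V ∩ adOrbit x,
      Module.finrank ℝ ((B.gradSpan (orbitInvariants K (adOrbit x)) y).map
        (toOrbitCotangent B y)) = d ∧
      Module.finrank ℝ ((B.kerOn y (B.gradSpan (orbitInvariants K (adOrbit x)) y)).map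
        (toOrbitCotangent B y)) = i

/-- `K` is an almost multiplicity free subgroup of `G`: its action on a generic adjoint
orbit of `G` has complexity one. -/
def IsAlmostMultiplicityFree (B : ScalarProduct (GroupLieAlgebra 𝓘(ℝ, E) G))
    (K : Subgroup G) : Prop :=
  ∃ U : Set (GroupLieAlgebra 𝓘(ℝ, E) G), IsOpen U ∧ Dense U ∧ ∀ x ∈ U, HasComplexity B K x 1

/-- `S` is a complete commutative set of `Ad K`-invariants: it consists of `Ad K`-invariant
polynomials that pairwise commute for the Lie–Poisson bracket, and `S + pr_𝔨^* ℝ[𝔨]` is complete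
on `𝔤`. -/
def IsCompleteCommutativeSetOfInvariants (B : ScalarProduct (GroupLieAlgebra 𝓘(ℝ, E) G))
    (F : Type*) [NormedAddCommGroup F] [NormedSpace ℝ F] (K : Subgroup G) [ChartedSpace F K]
    (S : Set (GroupLieAlgebra 𝓘(ℝ, E) G → ℝ)) : Prop :=
  S ⊆ invPoly (E := E) K ∧
  (∀ f ∈ S, ∀ g ∈ S, ∀ x, B.poissonBracket f g x = 0) ∧
  B.IsComplete ((Submodule.span ℝ S ⊔ B.liftedPoly (subgroupLieAlgebra F K) :
    Submodule ℝ (GroupLieAlgebra 𝓘(ℝ, E) G → ℝ)) : Set (GroupLieAlgebra 𝓘(ℝ, E) G → ℝ))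

end LieGroup

end

/-! At a point x write Z = ker Λ_x and N for the Λ_x-orthogonal of 𝔨. Two facts about skew forms are
used: dim(Z + 𝔨) + dim N = dim 𝔤 + dim Z, and the orthogonal of N is Z + 𝔨. Hence Λ_x has the same
kernel N ∩ (Z + 𝔨) on N and on Z + 𝔨.

For generic x the gradients of G-invariant polynomials span Z, those of K-invariant polynomials span
N, and those of lifted polynomials span 𝔨. On a generic orbit the differentials of K-invariant
functions form N/Z, so complexity one says dim N − dim(N ∩ (Z + 𝔨)) = 2. Thus Z + 𝔨 misses
completeness by exactly 2. The vector ∇p(x) lies in N and, by independence, outside Z + 𝔨; adjoining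
it raises both the dimension and the kernel dimension by one (`finrank_sup_span_singleton`), which
closes the gap. Commutativity holds because all gradients of the algebra lie in Z + ℝ∇p(x).

The analytic input is `exists_isOpen_dense_gradSpan_eq_orthogonal`: gradients of invariants
generically fill the normal space of the orbit, and the normal space of the K-orbit is N because its
tangent space is [𝔨, x]. Invariant polynomials separate orbits of a compact group (Stone–Weierstrass
and Haar averaging). Where their differentials have maximal rank, finitely many of them determine
all the others locally, so their common level set lies in one orbit; a curve in that level set is
then tangent to the orbit (`exists_mfderiv_eq_of_mem_orbit`). One such point suffices, since the
dimensions of spans of polynomial vector fields are generically constant. Identifying the tangent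
space requires the derivative of Ad to be the bracket (`mfderiv_adRep_apply`). -/

open Filter Topology

/-! ### Submersions and maps of constant rank -/

section ConstantRank

variable {X Y V : Type*} [NormedAddCommGroup X] [NormedSpace ℝ X] [FiniteDimensional ℝ X]
  [NormedAddCommGroup Y] [NormedSpace ℝ Y] [FiniteDimensional ℝ Y]
  [NormedAddCommGroup V] [NormedSpace ℝ V]

/-- A submersion is a projection in suitable local coordinates. -/
theorem ContDiffAt.exists_straightening {Ψ : X → Y} {x₀ : X} (hΨ : ContDiffAt ℝ 1 Ψ x₀)
    (hsurj : (fderiv ℝ Ψ x₀).range = ⊤) :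
    ∃ (κ : X → (fderiv ℝ Ψ x₀).ker) (s : Y × (fderiv ℝ Ψ x₀).ker → X),
      Continuous κ ∧ ContDiffAt ℝ 1 s (Ψ x₀, κ x₀) ∧ s (Ψ x₀, κ x₀) = x₀ ∧
      (∀ᶠ x in 𝓝 x₀, s (Ψ x, κ x) = x) ∧ ∀ᶠ q in 𝓝 (Ψ x₀, κ x₀), Ψ (s q) = q.1 := by
  have := FiniteDimensional.complete ℝ X
  have := FiniteDimensional.complete ℝ Y
  have := FiniteDimensional.complete ℝ (fderiv ℝ Ψ x₀).ker
  have hker : (fderiv ℝ Ψ x₀).ker.ClosedComplemented :=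
    (fderiv ℝ Ψ x₀).ker_closedComplemented_of_finiteDimensional_range
  let φ := (hΨ.hasStrictFDerivAt one_ne_zero).implicitFunctionDataOfComplemented Ψ _ hsurj hker
  have hr : ContDiff ℝ 1 φ.rightFun :=
    (Classical.choose hker).contDiff.comp (contDiff_id.sub contDiff_const)
  refine ⟨φ.rightFun, φ.implicitFunction.uncurry, hr.continuous,
    φ.contDiffAt_implicitFunction hΨ hr.contDiffAt one_ne_zero,
    φ.implicitFunction_apply_image.self_of_nhds, φ.implicitFunction_apply_image,
    φ.leftFun_implicitFunction⟩

/-- If `Ψ` is a submersion at `x₀`, then on a neighbourhood of `x₀` all functions whose derivatives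
vanish on the kernels of the derivatives of `Ψ` factor through `Ψ`. -/
theorem exists_nhds_eq_of_ker_fderiv_le {Ψ : X → Y} {U : Set X} (hU : IsOpen U) {x₀ : X}
    (hx₀ : x₀ ∈ U) (hΨ : ContDiffOn ℝ 1 Ψ U) (hsurj : (fderiv ℝ Ψ x₀).range = ⊤) :
    ∃ O ∈ 𝓝 x₀, ∀ Θ : X → V, (∀ x ∈ U, DifferentiableAt ℝ Θ x) →
      (∀ x ∈ U, (fderiv ℝ Ψ x).ker ≤ (fderiv ℝ Θ x).ker) →
      ∀ x ∈ O, ∀ x' ∈ O, Ψ x = Ψ x' → Θ x = Θ x' := by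
  have hΨ₀ : ContDiffAt ℝ 1 Ψ x₀ := hΨ.contDiffAt (hU.mem_nhds hx₀)
  obtain ⟨κ, s, hκ, hs, hs₀, hsl, hsr⟩ := hΨ₀.exists_straightening hsurj
  have hsU : ∀ᶠ q in 𝓝 (Ψ x₀, κ x₀), s q ∈ U :=
    hs.continuousAt.eventually_mem (by rw [hs₀]; exact hU.mem_nhds hx₀)
  obtain ⟨ε, hε, hball⟩ := Metric.eventually_nhds_iff_ball.1
    ((hs.eventually (by simp)).and (hsr.eventually_nhds.and hsU))
  have hcont : ContinuousAt (fun x => (Ψ x, κ x)) x₀ :=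
    hΨ₀.continuousAt.prodMk hκ.continuousAt
  -- The neighbourhood is fixed before `Θ`, so a single one serves infinitely many functions at
  -- once.
  refine ⟨_, (hcont.eventually_mem (Metric.ball_mem_nhds _ hε)).and hsl, ?_⟩
  rintro Θ hΘ hker x ⟨hx, hsx⟩ x' ⟨hx', hsx'⟩ hxx'
  rw [← ball_prod_same] at hx hx' hball
  -- In the straightened coordinates the fibre of `Ψ` is a ball in `w`; `Θ` has zero derivative
  -- along it, and a ball is connected.
  have key : ∀ w ∈ Metric.ball (κ x₀) ε, HasFDerivAt (fun w => Θ (s (Ψ x, w)))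
      (0 : (fderiv ℝ Ψ x₀).ker →L[ℝ] V) w := by
    intro w hw
    obtain ⟨h1, h2, h3⟩ := hball (Ψ x, w) ⟨hx.1, hw⟩
    have hds := (h1.differentiableAt one_ne_zero).hasFDerivAt
    have hinr : HasFDerivAt (fun w : (fderiv ℝ Ψ x₀).ker => (Ψ x, w))
        (ContinuousLinearMap.inr ℝ Y _) w := hasFDerivAt_prodMk_right _ _
    have hsw := hds.comp w hinr
    have hΨs : HasFDerivAt (fun w => Ψ (s (Ψ x, w)))
        ((fderiv ℝ Ψ (s (Ψ x, w))).comp ((fderiv ℝ s (Ψ x, w)).comp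
          (ContinuousLinearMap.inr ℝ Y _))) w :=
      (((hΨ.contDiffAt (hU.mem_nhds h3)).differentiableAt one_ne_zero).hasFDerivAt).comp w hsw
    have hev : (fun w => Ψ (s (Ψ x, w))) =ᶠ[𝓝 w] fun _ => Ψ x :=
      (hinr.continuousAt.eventually h2).mono fun _ h => h
    have hzero := hΨs.unique ((hasFDerivAt_const (Ψ x) w).congr_of_eventuallyEq hev)
    have hΘs : HasFDerivAt (fun w => Θ (s (Ψ x, w)))
        ((fderiv ℝ Θ (s (Ψ x, w))).comp ((fderiv ℝ s (Ψ x, w)).comp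
          (ContinuousLinearMap.inr ℝ Y _))) w := (hΘ _ h3).hasFDerivAt.comp w hsw
    convert hΘs using 1
    ext v
    exact (hker _ h3 (DFunLike.congr_fun hzero v)).symm
  have := Metric.isOpen_ball.is_const_of_fderiv_eq_zero (𝕜 := ℝ)
    (convex_ball (κ x₀) ε).isPreconnected
    (fun w hw => (key w hw).differentiableAt.differentiableWithinAt)
    (fun w hw => (key w hw).fderiv) hx.2 hx'.2
  simp only at this
  rwa [hsx, hxx', hsx'] at this

/-- A curve contained in the image of a map of constant rank is tangent to that image. -/
theorem mem_range_fderiv_of_constant_rank [FiniteDimensional ℝ V] {Φ : X → V} {U : Set X}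
    (hU : IsOpen U) {u₀ : X}
    (hu₀ : u₀ ∈ U) (hΦ : ContDiffOn ℝ 1 Φ U)
    (hrank : ∀ u ∈ U, Module.finrank ℝ (fderiv ℝ Φ u).range ≤
      Module.finrank ℝ (fderiv ℝ Φ u₀).range)
    {γ : ℝ → V} {v : V} (hγ : HasDerivAt γ v 0) {l : Filter ℝ} [l.NeBot] (hl : l ≤ 𝓝[≠] 0)
    {u : ℝ → X} (hu : Tendsto u l (𝓝 u₀)) (hγu : ∀ᶠ t in l, Φ (u t) = γ t) :
    v ∈ (fderiv ℝ Φ u₀).range := by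
  set T := (fderiv ℝ Φ u₀).range with hT
  obtain ⟨π, hπ⟩ : T.ClosedComplemented := Submodule.ClosedComplemented.of_finiteDimensional T
  have hdΦ : ∀ u ∈ U, HasFDerivAt Φ (fderiv ℝ Φ u) u := fun u hu =>
    ((hΦ.contDiffAt (hU.mem_nhds hu)).differentiableAt one_ne_zero).hasFDerivAt
  -- Projecting to the tangent image `T` makes the map a submersion at `u₀`.
  set Ψ : X → T := fun u => π (Φ u) with hΨdef
  have hdΨ : ∀ u ∈ U, fderiv ℝ Ψ u = π.comp (fderiv ℝ Φ u) := fun u hu =>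
    (π.hasFDerivAt.comp u (hdΦ u hu)).fderiv
  have hΨ : ContDiffOn ℝ 1 Ψ U := π.contDiff.comp_contDiffOn hΦ
  have hsurj : (fderiv ℝ Ψ u₀).range = ⊤ := by
    rw [hdΨ u₀ hu₀, eq_top_iff]
    rintro ⟨_, ⟨w, rfl⟩⟩ -
    exact ⟨w, hπ ⟨fderiv ℝ Φ u₀ w, w, rfl⟩⟩
  have hcont : ContinuousAt (fderiv ℝ Ψ) u₀ :=
    (hΨ.continuousOn_fderiv_of_isOpen hU le_rfl).continuousAt (hU.mem_nhds hu₀)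
  have hrk : ∀ᶠ u in 𝓝 u₀, (Module.finrank ℝ T : Cardinal) ≤
      (fderiv ℝ Ψ u : X →ₗ[ℝ] T).rank := by
    have hfull : (Module.finrank ℝ T : Cardinal) ≤ (fderiv ℝ Ψ u₀ : X →ₗ[ℝ] T).rank := by
      rw [LinearMap.rank, hsurj, rank_top, Module.finrank_eq_rank]
    exact hcont.eventually_mem ((isOpen_setOfPred_nat_le_rank (𝕜 := ℝ) (E := X) (F := T)
      (Module.finrank ℝ T)).mem_nhds hfull)
  obtain ⟨U', hU'sub, hU', hu₀'⟩ := mem_nhds_iff.1 (hrk.and (hU.mem_nhds hu₀))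
  -- Near `u₀` the rank of `Ψ` is at least dim `T`, while that of `Φ` is at most dim `T`; so the
  -- inclusion of kernels is an equality, and `Φ` factors locally through `Ψ`.
  have hkerle : ∀ u ∈ U', (fderiv ℝ Ψ u).ker ≤ (fderiv ℝ Φ u).ker := by
    intro u hu
    obtain ⟨h1, h2⟩ := hU'sub hu
    have hle : (fderiv ℝ Φ u).ker ≤ (fderiv ℝ Ψ u).ker := by
      rw [hdΨ u h2]
      intro w hw
      change π (fderiv ℝ Φ u w) = 0
      rw [show fderiv ℝ Φ u w = 0 from hw, map_zero]
    have e1 := (fderiv ℝ Φ u : X →ₗ[ℝ] V).finrank_range_add_finrank_ker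
    have e2 := (fderiv ℝ Ψ u : X →ₗ[ℝ] T).finrank_range_add_finrank_ker
    have h1' : Module.finrank ℝ T ≤ Module.finrank ℝ (fderiv ℝ Ψ u : X →ₗ[ℝ] T).range := by
      rw [LinearMap.rank, ← Module.finrank_eq_rank] at h1
      exact_mod_cast h1
    have h3 := hrank u h2
    have h4 : Module.finrank ℝ (fderiv ℝ Ψ u).ker ≤ Module.finrank ℝ (fderiv ℝ Φ u).ker := by
      have e1' : Module.finrank ℝ (fderiv ℝ Φ u).range + Module.finrank ℝ (fderiv ℝ Φ u).ker =
        Module.finrank ℝ X := e1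
      have e2' : Module.finrank ℝ (fderiv ℝ Ψ u).range + Module.finrank ℝ (fderiv ℝ Ψ u).ker =
        Module.finrank ℝ X := e2
      have h1'' : Module.finrank ℝ T ≤ Module.finrank ℝ (fderiv ℝ Ψ u).range := h1'
      omega
    exact (Submodule.eq_of_le_of_finrank_le hle h4).ge
  obtain ⟨O, hO, hfac⟩ := exists_nhds_eq_of_ker_fderiv_le (V := V) hU' hu₀'
    (hΨ.mono fun u hu => (hU'sub hu).2) hsurj
  have hfac := hfac Φ (fun u hu => (hdΦ u (hU'sub hu).2).differentiableAt) hkerle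
  obtain ⟨κ, s, -, hs, hs₀, -, hsr⟩ :=
    (hΨ.contDiffAt (hU.mem_nhds hu₀)).exists_straightening hsurj
  -- A local section of `Ψ`. The curve then satisfies γ = Φ ∘ g ∘ π ∘ γ along `l`, and the right
  -- side is differentiable even though `u` need not be.
  set g : T → X := fun t => s (t, κ u₀) with hg
  have hgd : DifferentiableAt ℝ g (Ψ u₀) :=
    (hs.differentiableAt one_ne_zero).comp (Ψ u₀)
      (differentiableAt_id.prodMk (differentiableAt_const _))
  have hg₀ : g (Ψ u₀) = u₀ := hs₀
  have hgr : ∀ᶠ t in 𝓝 (Ψ u₀), Ψ (g t) = t :=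
    ((continuous_id.prodMk continuous_const).continuousAt (x := Ψ u₀)
      (f := fun t => (t, κ u₀))).eventually hsr
  have hΦu : Tendsto (fun t => Φ (u t)) l (𝓝 (Φ u₀)) :=
    ((hdΦ u₀ hu₀).continuousAt.tendsto).comp hu
  have hγ₀ : γ 0 = Φ u₀ :=
    tendsto_nhds_unique (((hγ.continuousAt.tendsto).mono_left (hl.trans nhdsWithin_le_nhds)).congr'
      (hγu.mono fun t h => h.symm)) hΦu
  have hΨu : Tendsto (fun t => Ψ (u t)) l (𝓝 (Ψ u₀)) := (π.continuous.tendsto _).comp hΦu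
  have hδ : HasDerivAt (fun t => Φ (g (π (γ t))))
      (fderiv ℝ Φ u₀ (fderiv ℝ g (Ψ u₀) (π v))) 0 := by
    have h1 : HasDerivAt (fun t => π (γ t)) (π v) 0 := π.hasFDerivAt.comp_hasDerivAt 0 hγ
    have h2 : HasFDerivAt g (fderiv ℝ g (Ψ u₀)) (π (γ 0)) := by
      rw [hγ₀]; exact hgd.hasFDerivAt
    have h3 : HasFDerivAt Φ (fderiv ℝ Φ u₀) (g (π (γ 0))) := by
      rw [hγ₀, show g (π (Φ u₀)) = u₀ from hg₀]; exact hdΦ u₀ hu₀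
    have h4 := HasFDerivAt.comp_hasDerivAt (f := fun t => π (γ t)) 0 h2 h1
    exact h3.comp_hasDerivAt 0 h4
  have hgO : ∀ᶠ t in l, g (Ψ (u t)) ∈ O :=
    (hgd.continuousAt.tendsto.comp hΨu).eventually_mem (by rw [hg₀]; exact hO)
  have heq : ∀ᶠ t in l, γ t = Φ (g (π (γ t))) := by
    filter_upwards [hγu, hu.eventually_mem hO, hgO, hΨu.eventually hgr] with t h1 h2 h3 h4
    rw [← h1]
    exact hfac _ h2 _ h3 h4.symm
  have hl1 := (hasDerivAt_iff_tendsto_slope.1 hγ).mono_left hl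
  have hl2 := (hasDerivAt_iff_tendsto_slope.1 hδ).mono_left hl
  have : v = fderiv ℝ Φ u₀ (fderiv ℝ g (Ψ u₀) (π v)) := by
    refine tendsto_nhds_unique hl1 (hl2.congr' ?_)
    filter_upwards [heq] with t ht
    rw [slope_def_module, slope_def_module, ← ht]
    congr 2
    rw [hγ₀, show g (π (Φ u₀)) = u₀ from hg₀]
  rw [this]
  exact ⟨_, rfl⟩

end ConstantRank

/-! ### Invariant polynomials separate orbits of compact groups -/

section Separation

open MeasureTheory

variable {V : Type*} [NormedAddCommGroup V] [NormedSpace ℝ V] [FiniteDimensional ℝ V]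

theorem dual_mem_polyFun {V : Type*} [AddCommGroup V] [Module ℝ V] (φ : Module.Dual ℝ V) :
    (fun v => φ v) ∈ polyFun V :=
  Algebra.subset_adjoin ⟨φ, rfl⟩

theorem contDiff_of_mem_polyFun {n : WithTop ℕ∞} {p : V → ℝ} (hp : p ∈ polyFun V) :
    ContDiff ℝ n p := by
  induction hp using Algebra.adjoin_induction with
  | mem p hp =>
    obtain ⟨φ, rfl⟩ := hp
    exact (LinearMap.toContinuousLinearMap φ).contDiff
  | algebraMap r => exact contDiff_const
  | add p q _ _ hp hq => exact hp.add hq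
  | mul p q _ _ hp hq => exact hp.mul hq

theorem continuous_of_mem_polyFun {p : V → ℝ} (hp : p ∈ polyFun V) : Continuous p :=
  (contDiff_of_mem_polyFun (n := 0) hp).continuous

variable {H : Type*} [Group H] (ρ : H →* Module.End ℝ V)

/-- The polynomial functions on a representation that are invariant under the group. -/
def Representation.invariantPoly : Set (V → ℝ) :=
  {p | p ∈ polyFun V ∧ ∀ h x, p (ρ h x) = p x}

variable [TopologicalSpace H] {ρ}

/-- Separating the group variable from the vector variable shows that averaging a polynomial over
the group only averages the coefficients, so the average is again a polynomial. -/
theorem exists_sum_mul_eq_of_mem_polyFun (hρ : ∀ v, Continuous fun h => ρ h v) {q : V → ℝ}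
    (hq : q ∈ polyFun V) :
    ∃ (ι : Type) (_ : Fintype ι) (a : ι → H → ℝ) (b : ι → V → ℝ), (∀ i, Continuous (a i)) ∧
      (∀ i, b i ∈ polyFun V) ∧ ∀ h v, q (ρ h v) = ∑ i, a i h * b i v := by
  induction hq using Algebra.adjoin_induction with
  | mem p hp =>
    obtain ⟨φ, rfl⟩ := hp
    let e := Module.finBasis ℝ V
    refine ⟨Fin (Module.finrank ℝ V), inferInstance, fun i h => φ (ρ h (e i)),
      fun i v => e.coord i v, fun i => φ.continuous_of_finiteDimensional.comp (hρ _),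
      fun i => dual_mem_polyFun _, fun h v => ?_⟩
    conv_lhs => rw [← e.sum_repr v]
    simp only [map_sum, map_smul, smul_eq_mul, e.coord_apply]
    exact Finset.sum_congr rfl fun _ _ => mul_comm _ _
  | algebraMap r =>
    exact ⟨Unit, inferInstance, fun _ _ => r, fun _ => 1, fun _ => continuous_const,
      fun _ => one_mem _, fun h v => by simp⟩
  | add p q _ _ hp hq =>
    obtain ⟨ι, _, a, b, ha, hb, hab⟩ := hp
    obtain ⟨κ, _, c, d, hc, hd, hcd⟩ := hq
    refine ⟨ι ⊕ κ, inferInstance, Sum.elim a c, Sum.elim b d, ?_, ?_, fun h v => ?_⟩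
    · rintro (i | i)
      exacts [ha i, hc i]
    · rintro (i | i)
      exacts [hb i, hd i]
    · simp [hab, hcd]
  | mul p q _ _ hp hq =>
    obtain ⟨ι, _, a, b, ha, hb, hab⟩ := hp
    obtain ⟨κ, _, c, d, hc, hd, hcd⟩ := hq
    refine ⟨ι × κ, inferInstance, fun i h => a i.1 h * c i.2 h, fun i v => b i.1 v * d i.2 v,
      fun i => (ha _).mul (hc _), fun i => mul_mem (hb _) (hd _), fun h v => ?_⟩
    simp only [Pi.mul_apply, hab, hcd, Finset.sum_mul_sum, Fintype.sum_prod_type]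
    exact Finset.sum_congr rfl fun _ _ => Finset.sum_congr rfl fun _ _ => by ring

/-- The invariant polynomials of a compact group separate its orbits. -/
theorem exists_invariantPoly_ne [IsTopologicalGroup H] [CompactSpace H]
    (hρ : ∀ v, Continuous fun h => ρ h v) {x y : V} (hxy : y ∉ Set.range fun h => ρ h x) :
    ∃ p ∈ Representation.invariantPoly ρ, p x ≠ p y := by
  borelize H
  set μ : Measure H := Measure.haar
  have hint : ∀ f : H → ℝ, Continuous f → Integrable f μ := fun f hf =>
    hf.integrable_of_hasCompactSupport (HasCompactSupport.of_compactSpace f)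
  have hcx : IsCompact (Set.range fun h => ρ h x) := isCompact_range (hρ x)
  have hcy : IsCompact (Set.range fun h => ρ h y) := isCompact_range (hρ y)
  have hdisj : Disjoint (Set.range fun h => ρ h x) (Set.range fun h => ρ h y) := by
    rw [Set.disjoint_left]
    rintro _ ⟨h, rfl⟩ ⟨k, hk⟩
    refine hxy ⟨k⁻¹ * h, ?_⟩
    simp only at hk
    simp only [map_mul, Module.End.mul_apply]
    rw [← hk, ← Module.End.mul_apply, ← map_mul, inv_mul_cancel, map_one, Module.End.one_apply]
  obtain ⟨g, hg0, hg1, -⟩ :=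
    exists_continuous_zero_one_of_isClosed hcx.isClosed hcy.isClosed hdisj
  let A : Subalgebra ℝ C(V, ℝ) := (polyFun V).comap (ContinuousMap.coeFnAlgHom ℝ)
  have hsep : A.SeparatesPoints := by
    intro v w hvw
    obtain ⟨φ, hφ⟩ := Module.Projective.exists_dual_ne_zero ℝ (sub_ne_zero.2 hvw)
    refine ⟨φ, ⟨⟨φ, φ.continuous_of_finiteDimensional⟩, dual_mem_polyFun φ, rfl⟩, fun h => hφ ?_⟩
    rw [map_sub, h, sub_self]
  -- An error below 1/4 against the values 0 and 1 leaves a gap of more than 1/2 between the two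
  -- orbits, which survives averaging.
  obtain ⟨q, hqA, hq⟩ :=
    ContinuousMap.exists_mem_subalgebra_near_continuous_of_isCompact_of_separatesPoints
    hsep g (hcx.union hcy) (show (0 : ℝ) < 1 / 4 by norm_num)
  replace hqA : (q : V → ℝ) ∈ polyFun V := hqA
  have hqc := continuous_of_mem_polyFun hqA
  have hcont : ∀ v, Continuous fun h : H => (q : V → ℝ) (ρ h⁻¹ v) := fun v =>
    hqc.comp ((hρ v).comp continuous_inv)
  -- Averaging over `h⁻¹` makes invariance of the result a consequence of left invariance of Haar
  -- measure.
  refine ⟨fun v => ∫ h, (q : V → ℝ) (ρ h⁻¹ v) ∂μ, ⟨?_, fun k v => ?_⟩, ?_⟩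
  · obtain ⟨ι, _, a, b, ha, hb, hab⟩ := exists_sum_mul_eq_of_mem_polyFun hρ hqA
    have : (fun v => ∫ h, (q : V → ℝ) (ρ h⁻¹ v) ∂μ) =
        ∑ i, (∫ h, a i h⁻¹ ∂μ) • b i := by
      ext v
      simp only [hab, Finset.sum_apply, Pi.smul_apply, smul_eq_mul]
      rw [integral_finsetSum _ fun i _ =>
        hint (fun h => a i h⁻¹ * b i v) (((ha i).comp continuous_inv).mul continuous_const)]
      simp only [integral_mul_const]
    rw [this]
    exact sum_mem fun i _ => Subalgebra.smul_mem _ (hb i) _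
  · have := integral_mul_left_eq_self (μ := μ) (fun h => (q : V → ℝ) (ρ h⁻¹ (ρ k v))) k
    simp only at this ⊢
    rw [← this]
    refine integral_congr_ae (Eventually.of_forall fun h => ?_)
    simp only [mul_inv_rev]
    rw [← Module.End.mul_apply, ← map_mul, inv_mul_cancel_right]
  · have hpos : 0 < μ.real Set.univ :=
      ENNReal.toReal_pos (NeZero.ne _) (measure_ne_top _ _)
    have hx : ∀ h : H, (q : V → ℝ) (ρ h⁻¹ x) - (q : V → ℝ) (ρ h⁻¹ y) ≤ -(1 / 2) := by
      intro h
      have h1 := hq (ρ h⁻¹ x) (Or.inl ⟨_, rfl⟩)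
      have h2 := hq (ρ h⁻¹ y) (Or.inr ⟨_, rfl⟩)
      rw [hg0 ⟨_, rfl⟩] at h1
      rw [hg1 ⟨_, rfl⟩] at h2
      simp only [Real.norm_eq_abs, Pi.zero_apply, Pi.one_apply] at h1 h2
      have h1 := abs_lt.1 h1
      have h2 := abs_lt.1 h2
      linarith
    have hle := integral_mono (μ := μ) ((hint _ (hcont x)).sub (hint _ (hcont y)))
      (integrable_const (-(1 / 2) : ℝ)) hx
    have hsub := integral_sub (hint _ (hcont x)) (hint _ (hcont y))
    rw [integral_const, smul_eq_mul] at hle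
    simp only [Pi.sub_apply] at hle
    intro heq
    simp only at heq
    rw [hsub, heq, sub_self] at hle
    linarith
end Separation

theorem exists_forall_le_of_forall_le {α : Type*} {s : Set α} (hs : s.Nonempty) (f : α → ℕ) {b : ℕ}
    (hb : ∀ a ∈ s, f a ≤ b) : ∃ a ∈ s, ∀ z ∈ s, f z ≤ f a := by
  have hbdd : BddAbove (f '' s) := ⟨b, by rintro _ ⟨a, ha, rfl⟩; exact hb a ha⟩
  obtain ⟨a, ha, hfa⟩ := Nat.sSup_mem (hs.image f) hbdd
  exact ⟨a, ha, fun z hz => hfa ▸ le_csSup hbdd ⟨z, hz, rfl⟩⟩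

/-- Linearly independent functionals are the components of a surjective map. -/
theorem range_pi_eq_top_of_linearIndependent {K M ι : Type*} [Field K] [AddCommGroup M] [Module K M]
    [Finite ι] {f : ι → Module.Dual K M} (hf : LinearIndependent K f) :
    LinearMap.range (LinearMap.pi f) = ⊤ := by
  have := Fintype.ofFinite ι
  classical
  by_contra h
  obtain ⟨g, hg, hle⟩ := Submodule.exists_le_ker_of_lt_top _ (lt_top_iff_ne_top.2 h)
  refine hg (LinearMap.pi_ext' fun i => LinearMap.ext_ring ?_)
  have hsum : ∑ i, g (Pi.single i 1) • f i = 0 := by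
    ext m
    have : g (LinearMap.pi f m) = 0 := hle ⟨m, rfl⟩
    rw [LinearMap.pi_apply_eq_sum_univ g] at this
    rw [LinearMap.sum_apply, LinearMap.zero_apply, ← this]
    refine Finset.sum_congr rfl fun i _ => ?_
    have hs : (fun j => if i = j then (1 : K) else 0) = Pi.single i 1 := by
      ext j
      simp [Pi.single_apply, eq_comm]
    rw [hs, LinearMap.smul_apply, smul_eq_mul, smul_eq_mul, mul_comm, LinearMap.pi_apply]
  simpa using Fintype.linearIndependent_iff.1 hf _ hsum i

/-! ### Tangent spaces of orbits and differentials of invariants -/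

section Orbits

variable {V : Type*} [NormedAddCommGroup V] [NormedSpace ℝ V] [FiniteDimensional ℝ V]
  {F : Type*} [NormedAddCommGroup F] [NormedSpace ℝ F] [FiniteDimensional ℝ F]
  {H : Type*} [TopologicalSpace H] [ChartedSpace F H] [Group H] [LieGroup 𝓘(ℝ, F) ∞ H]
  [CompactSpace H] {ρ : H →* Module.End ℝ V}

/-- A curve contained in an orbit of a compact Lie group is tangent to the orbit. -/
theorem exists_mfderiv_eq_of_mem_orbit
    (hρ : ∀ v, ContMDiff 𝓘(ℝ, F) 𝓘(ℝ, V) 1 fun h => ρ h v) {γ : ℝ → V} {y v : V}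
    (hγ : HasDerivAt γ v 0) (hy : γ 0 = y)
    (horb : ∀ᶠ t in 𝓝[≠] 0, γ t ∈ Set.range fun h => ρ h y) :
    ∃ w, mfderiv 𝓘(ℝ, F) 𝓘(ℝ, V) (fun h => ρ h y) 1 w = v := by
  have : IsTopologicalGroup H := topologicalGroup_of_lieGroup 𝓘(ℝ, F) ∞
  have : IsManifold 𝓘(ℝ, F) 1 H := IsManifold.of_le (n := ∞) (by simp)
  have hmul : ∀ g x y, ρ (g * x) y = ρ g (ρ x y) := fun g x y => by
    rw [map_mul, Module.End.mul_apply]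
  choose! h hh using fun t (ht : γ t ∈ Set.range fun h => ρ h y) => ht
  -- The elements `h t` need not depend continuously on `t`. By compactness they converge along an
  -- ultrafilter to some `k`, which fixes `y`; then `h t * k⁻¹` still moves `y` to `γ t` and tends
  -- to 1.
  set l : Ultrafilter ℝ := Ultrafilter.of (𝓝[≠] 0)
  have hl : (l : Filter ℝ) ≤ 𝓝[≠] 0 := Ultrafilter.of_le _
  obtain ⟨k, -, hk⟩ := isCompact_univ.ultrafilter_le_nhds (l.map h) (by simp)
  have hk : Tendsto h l (𝓝 k) := hk
  have hcont : ∀ v, Continuous fun h => ρ h v := fun v => (hρ v).continuous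
  have hγh : ∀ᶠ t in l, ρ (h t) y = γ t := (horb.filter_mono hl).mono fun t ht => hh t ht
  have hky : ρ k y = y := by
    refine tendsto_nhds_unique (((hcont y).tendsto k).comp hk) ?_
    have : Tendsto γ l (𝓝 y) := hy ▸ hγ.continuousAt.tendsto.mono_left
      (hl.trans nhdsWithin_le_nhds)
    exact this.congr' (hγh.mono fun t ht => ht.symm)
  have hky' : ρ k⁻¹ y = y := by
    conv_lhs => rw [← hky]
    rw [← hmul, inv_mul_cancel, map_one, Module.End.one_apply]
  have hk1 : Tendsto (fun t => h t * k⁻¹) l (𝓝 1) := by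
    simpa using hk.mul_const k⁻¹
  set φ := extChartAt 𝓘(ℝ, F) (1 : H) with hφ
  have hopen : IsOpen φ.target := isOpen_extChartAt_target 1
  have hφ1 : φ 1 ∈ φ.target := mem_extChartAt_target 1
  have hsymm : ∀ u ∈ φ.target, ContMDiffAt 𝓘(ℝ, F) 𝓘(ℝ, F) 1 φ.symm u := fun u hu =>
    (contMDiffOn_extChartAt_symm (1 : H)).contMDiffAt (hopen.mem_nhds hu)
  set Φ : F → V := fun u => ρ (φ.symm u) y with hΦdef
  have hΦ : ∀ u ∈ φ.target, ContDiffAt ℝ 1 Φ u := fun u hu =>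
    ((hρ y).contMDiffAt.comp u (hsymm u hu)).contDiffAt
  have hΦd : ∀ u ∈ φ.target, DifferentiableAt ℝ Φ u := fun u hu =>
    (hΦ u hu).differentiableAt one_ne_zero
  have hφsymm1 : φ.symm (φ 1) = 1 := extChartAt_to_inv (1 : H)
  have hmem : v ∈ (fderiv ℝ Φ (φ 1)).range := by
    refine mem_range_fderiv_of_constant_rank hopen hφ1
      (fun u hu => (hΦ u hu).contDiffWithinAt) (fun u hu => ?_) hγ hl
      (u := fun t => φ (h t * k⁻¹)) ((continuousAt_extChartAt 1).tendsto.comp hk1) ?_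
    -- Equivariance bounds the rank: near `u`, `Φ` is `ρ g ∘ Φ ∘ ψ` with `ψ u = φ 1`, so its rank at
    -- `u` is at most that at `φ 1`.
    · set g := φ.symm u with hg
      set ψ : F → F := fun u' => φ (g⁻¹ * φ.symm u') with hψdef
      have hψu : ψ u = φ 1 := by rw [hψdef]; simp only [← hg, inv_mul_cancel]
      have hψ1 : ContMDiffAt 𝓘(ℝ, F) 𝓘(ℝ, F) 1 (fun u' => g⁻¹ * φ.symm u') u :=
        ((contMDiff_mul_left (I := 𝓘(ℝ, F)) (n := ∞) (a := g⁻¹)).of_le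
          (by simp)).contMDiffAt.comp u (hsymm u hu)
      have hgu : g⁻¹ * φ.symm u = 1 := by rw [← hg, inv_mul_cancel]
      have hψ : DifferentiableAt ℝ ψ u := by
        have h1 : ContMDiffAt 𝓘(ℝ, F) 𝓘(ℝ, F) 1 φ (g⁻¹ * φ.symm u) := by
          rw [hgu]; exact contMDiffAt_extChartAt
        have h2 : ContMDiffAt 𝓘(ℝ, F) 𝓘(ℝ, F) 1 ψ u :=
          ContMDiffAt.comp (g := φ) (f := fun u' => g⁻¹ * φ.symm u') u h1 hψ1
        exact h2.contDiffAt.differentiableAt one_ne_zero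
      have hev : Φ =ᶠ[𝓝 u] fun u' => ρ g (Φ (ψ u')) := by
        have hsrc : ∀ᶠ u' in 𝓝 u, g⁻¹ * φ.symm u' ∈ φ.source :=
          hψ1.continuousAt.eventually_mem (by
            rw [hgu]; exact (isOpen_extChartAt_source 1).mem_nhds (mem_extChartAt_source 1))
        filter_upwards [hsrc] with u' hu'
        simp only [hΦdef, hψdef]
        rw [φ.left_inv hu', ← hmul, mul_inv_cancel_left]
      have hder : HasFDerivAt Φ ((LinearMap.toContinuousLinearMap (ρ g)).comp
          ((fderiv ℝ Φ (φ 1)).comp (fderiv ℝ ψ u))) u := by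
        refine HasFDerivAt.congr_of_eventuallyEq ?_ hev
        refine (LinearMap.toContinuousLinearMap (ρ g)).hasFDerivAt.comp u ?_
        have h3 : HasFDerivAt Φ (fderiv ℝ Φ (φ 1)) (ψ u) := by
          rw [hψu]
          exact (hΦd _ hφ1).hasFDerivAt
        exact h3.comp u hψ.hasFDerivAt
      rw [hder.fderiv]
      have hle : ((LinearMap.toContinuousLinearMap (ρ g)).comp
          ((fderiv ℝ Φ (φ 1)).comp (fderiv ℝ ψ u))).range ≤
          (fderiv ℝ Φ (φ 1)).range.map (ρ g) := by
        rintro _ ⟨x, rfl⟩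
        exact ⟨_, ⟨fderiv ℝ ψ u x, rfl⟩, rfl⟩
      exact (Submodule.finrank_mono hle).trans (Submodule.finrank_map_le _ _)
    · have hsrc : ∀ᶠ t in l, h t * k⁻¹ ∈ φ.source :=
        hk1.eventually_mem ((isOpen_extChartAt_source 1).mem_nhds (mem_extChartAt_source 1))
      filter_upwards [hsrc, hγh] with t h1 h2
      simp only [hΦdef]
      rw [φ.left_inv h1, hmul, hky', h2]
  obtain ⟨w, hw⟩ := hmem
  have hchain : HasMFDerivAt 𝓘(ℝ, F) 𝓘(ℝ, V) Φ (φ 1)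
      ((mfderiv 𝓘(ℝ, F) 𝓘(ℝ, V) (fun h => ρ h y) (φ.symm (φ 1))).comp
        (mfderiv 𝓘(ℝ, F) 𝓘(ℝ, F) φ.symm (φ 1))) :=
    ((hρ y).mdifferentiable one_ne_zero _).hasMFDerivAt.comp (φ 1)
      ((hsymm _ hφ1).mdifferentiableAt one_ne_zero).hasMFDerivAt
  have hw' : mfderiv 𝓘(ℝ, F) 𝓘(ℝ, V) Φ (φ 1) w = v := by
    rw [mfderiv_eq_fderiv]
    exact hw
  rw [hchain.mfderiv] at hw'
  have hcast : ∀ a : H, a = 1 → ∀ (w : TangentSpace 𝓘(ℝ, F) a),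
      mfderiv 𝓘(ℝ, F) 𝓘(ℝ, V) (fun h => ρ h y) a w = v →
      ∃ w, mfderiv 𝓘(ℝ, F) 𝓘(ℝ, V) (fun h => ρ h y) 1 w = v := by
    rintro _ rfl w hw
    exact ⟨w, hw⟩
  exact hcast _ hφsymm1 _ hw'

/-- For a representation of a compact Lie group, there are points in every open set at which the
differentials of the invariant polynomials cut out the tangent space of the orbit. -/
theorem exists_mem_forall_fderiv_eq_zero_imp
    (hρ : ∀ v, ContMDiff 𝓘(ℝ, F) 𝓘(ℝ, V) 1 fun h => ρ h v) {U : Set V} (hU : IsOpen U)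
    (hne : U.Nonempty) :
    ∃ y ∈ U, ∀ v, (∀ p ∈ Representation.invariantPoly ρ, fderiv ℝ p y v = 0) →
      ∃ w, mfderiv 𝓘(ℝ, F) 𝓘(ℝ, V) (fun h => ρ h y) 1 w = v := by
  have : IsTopologicalGroup H := topologicalGroup_of_lieGroup 𝓘(ℝ, F) ∞
  have := FiniteDimensional.complete ℝ V
  have hsm : ∀ p ∈ Representation.invariantPoly ρ, ContDiff ℝ 1 p := fun p hp =>
    contDiff_of_mem_polyFun hp.1
  let S : V → Submodule ℝ (V →L[ℝ] ℝ) := fun z =>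
    Submodule.span ℝ ((fun p => fderiv ℝ p z) '' Representation.invariantPoly ρ)
  -- The point is chosen where the differentials of the invariants span a space of maximal dimension
  -- in `U`. Nearby, a basis chosen at `y` still spans all differentials.
  obtain ⟨y, hyU, hmax⟩ := exists_forall_le_of_forall_le hne (fun z => Module.finrank ℝ (S z))
    (fun z _ => Submodule.finrank_le (S z))
  refine ⟨y, hyU, fun v hv => ?_⟩
  obtain ⟨b, hbsub, hbspan, hbli⟩ :=
    exists_linearIndependent ℝ ((fun p => fderiv ℝ p y) '' Representation.invariantPoly ρ)
  have : Finite b := hbli.finite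
  have := Fintype.ofFinite b
  choose q hq hqb using fun i : b => hbsub i.2
  have hcontd : ∀ i, Continuous (fderiv ℝ (q i)) := fun i =>
    (hsm _ (hq i)).continuous_fderiv one_ne_zero
  set U' : Set V := {z ∈ U | LinearIndependent ℝ fun i => fderiv ℝ (q i) z} with hU'def
  have hU' : IsOpen U' := hU.inter
    ((isOpen_setOfPred_linearIndependent (𝕜 := ℝ) (E := V →L[ℝ] ℝ) (ι := b)).preimage
      (continuous_pi hcontd))
  have hyU' : y ∈ U' := ⟨hyU, by
    rw [show (fun i : b => fderiv ℝ (q i) y) = Subtype.val from funext hqb]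
    exact hbli⟩
  set Ψ : V → b → ℝ := fun z i => q i z with hΨdef
  have hΨ : ContDiff ℝ 1 Ψ := contDiff_pi.2 fun i => hsm _ (hq i)
  have hdΨ : ∀ z, fderiv ℝ Ψ z = ContinuousLinearMap.pi fun i => fderiv ℝ (q i) z := fun z =>
    (hasFDerivAt_pi.2 fun i => ((hsm _ (hq i)).differentiable one_ne_zero z).hasFDerivAt).fderiv
  have hsurj : (fderiv ℝ Ψ y).range = ⊤ := by
    rw [hdΨ]
    refine range_pi_eq_top_of_linearIndependent (f := fun i => (fderiv ℝ (q i) y : V →ₗ[ℝ] ℝ)) ?_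
    exact hyU'.2.map' (ContinuousLinearMap.coeLM ℝ)
      (LinearMap.ker_eq_bot.2 ContinuousLinearMap.coe_injective)
  have hker : ∀ p ∈ Representation.invariantPoly ρ, ∀ z ∈ U',
      (fderiv ℝ Ψ z).ker ≤ (fderiv ℝ p z).ker := by
    intro p hp z hz w hw
    have hle : Submodule.span ℝ (Set.range fun i => fderiv ℝ (q i) z) ≤ S z :=
      Submodule.span_mono (by rintro _ ⟨i, rfl⟩; exact ⟨q i, hq i, rfl⟩)
    have heq : Submodule.span ℝ (Set.range fun i => fderiv ℝ (q i) z) = S z := by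
      refine Submodule.eq_of_le_of_finrank_le hle ((hmax z hz.1).trans ?_)
      rw [finrank_span_eq_card hz.2]
      have : Module.finrank ℝ (S y) = Fintype.card b := by
        rw [← (LinearEquiv.ofEq _ _ hbspan).finrank_eq, ← Set.toFinset_card]
        exact finrank_span_set_eq_card hbli
      exact this.le
    have hpS : fderiv ℝ p z ∈ Submodule.span ℝ (Set.range fun i => fderiv ℝ (q i) z) := by
      rw [heq]; exact Submodule.subset_span ⟨p, hp, rfl⟩
    have hw' : ∀ i, fderiv ℝ (q i) z w = 0 := by
      intro i
      have h0 : fderiv ℝ Ψ z w = 0 := hw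
      rw [hdΨ] at h0
      exact congrFun h0 i
    change fderiv ℝ p z w = 0
    refine Submodule.span_induction (p := fun x _ => x w = 0) ?_ rfl ?_ ?_ hpS
    · rintro _ ⟨i, rfl⟩
      exact hw' i
    · intro x x' _ _ hx hx'
      rw [add_apply, hx, hx', add_zero]
    · intro c x _ hx
      rw [smul_apply, hx, smul_zero]
  obtain ⟨O, hO, hfac⟩ :=
    exists_nhds_eq_of_ker_fderiv_le (V := ℝ) hU' hyU' hΨ.contDiffOn hsurj
  have hstrict := (hΨ.contDiffAt (x := y)).hasStrictFDerivAt one_ne_zero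
  have hvker : v ∈ (fderiv ℝ Ψ y).ker := by
    change fderiv ℝ Ψ y v = 0
    rw [hdΨ]
    ext i
    exact hv _ (hq i)
  -- The line through `v` in the kernel is lifted by the implicit function to a curve in the level
  -- set of `Ψ` with velocity `v`.
  set γ : ℝ → V := fun t => hstrict.implicitFunction Ψ _ hsurj (Ψ y) (t • ⟨v, hvker⟩) with hγdef
  have hγ0 : γ 0 = y := by
    simp only [hγdef, zero_smul]
    exact hstrict.implicitFunction_apply_image hsurj
  have hline : HasDerivAt (fun t : ℝ => t • (⟨v, hvker⟩ : (fderiv ℝ Ψ y).ker)) ⟨v, hvker⟩ 0 := by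
    simpa using (hasDerivAt_id (0 : ℝ)).smul_const (⟨v, hvker⟩ : (fderiv ℝ Ψ y).ker)
  have hγ : HasDerivAt γ v 0 := by
    have h1 := (hstrict.to_implicitFunction hsurj).hasFDerivAt
    rw [← zero_smul ℝ (⟨v, hvker⟩ : (fderiv ℝ Ψ y).ker)] at h1
    exact HasFDerivAt.comp_hasDerivAt (0 : ℝ) h1 hline
  refine exists_mfderiv_eq_of_mem_orbit hρ hγ hγ0 (Eventually.filter_mono nhdsWithin_le_nhds ?_)
  have hγO : ∀ᶠ t in 𝓝 0, γ t ∈ O := hγ.continuousAt.eventually_mem (by rw [hγ0]; exact hO)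
  have hlevel : ∀ᶠ t in 𝓝 (0 : ℝ), Ψ (γ t) = Ψ y := by
    have hc : ContinuousAt (fun t : ℝ => (Ψ y, t • (⟨v, hvker⟩ : (fderiv ℝ Ψ y).ker))) 0 :=
      continuousAt_const.prodMk hline.continuousAt
    have h1 := hstrict.map_implicitFunction_eq hsurj
    exact hc.eventually (p := fun q => Ψ (hstrict.implicitFunction Ψ _ hsurj q.1 q.2) = q.1)
      (by simpa only [zero_smul] using h1)
  filter_upwards [hγO, hlevel] with t h1 h2
  -- Off the orbit some invariant polynomial would separate `γ t` from `y`, although it is a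
  -- function of `Ψ` on `O`.
  by_contra hnot
  obtain ⟨p, hp, hne⟩ := exists_invariantPoly_ne (fun v => (hρ v).continuous) hnot
  exact hne (hfac p (fun x _ => (hsm p hp).differentiable one_ne_zero x) (hker p hp) _ h1 _
    (mem_of_mem_nhds hO) h2).symm

end Orbits

/-! ### The adjoint representation and its derivative -/

section AdjointRepresentation

variable {E : Type*} [NormedAddCommGroup E] [NormedSpace ℝ E]
  {G : Type*} [TopologicalSpace G] [ChartedSpace E G] [Group G]

/-- The chain rule for `mfderiv`, for tangent vectors regarded as vectors in the model spaces and
with a free choice of the expression for the intermediate point. -/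
theorem mfderiv_comp_apply_model {E₁ E₂ E₃ M₁ M₂ M₃ : Type*}
    [NormedAddCommGroup E₁] [NormedSpace ℝ E₁] [TopologicalSpace M₁] [ChartedSpace E₁ M₁]
    [NormedAddCommGroup E₂] [NormedSpace ℝ E₂] [TopologicalSpace M₂] [ChartedSpace E₂ M₂]
    [NormedAddCommGroup E₃] [NormedSpace ℝ E₃] [TopologicalSpace M₃] [ChartedSpace E₃ M₃]
    {f : M₁ → M₂} {g : M₂ → M₃} {x : M₁} {y : M₂}
    (hg : MDifferentiableAt 𝓘(ℝ, E₂) 𝓘(ℝ, E₃) g y) (hf : MDifferentiableAt 𝓘(ℝ, E₁) 𝓘(ℝ, E₂) f x)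
    (hy : f x = y) (v : E₁) :
    (mfderiv 𝓘(ℝ, E₁) 𝓘(ℝ, E₃) (fun z => g (f z)) x v : E₃) =
      (mfderiv 𝓘(ℝ, E₂) 𝓘(ℝ, E₃) g y (mfderiv 𝓘(ℝ, E₁) 𝓘(ℝ, E₂) f x v : E₂) : E₃) := by
  subst hy
  exact mfderiv_comp_apply x hg hf v

theorem Ad_one : Ad (1 : G) = ContinuousLinearMap.id ℝ (GroupLieAlgebra 𝓘(ℝ, E) G) := by
  have : (fun h : G => 1 * h * 1⁻¹) = id := by ext; simp
  rw [Ad, this]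
  exact mfderiv_id

variable [LieGroup 𝓘(ℝ, E) ∞ G]

theorem contMDiff_conj (g : G) : ContMDiff 𝓘(ℝ, E) 𝓘(ℝ, E) ∞ fun h : G => g * h * g⁻¹ :=
  (contMDiff_const.mul contMDiff_id).mul contMDiff_const

theorem Ad_mul (g h : G) (v : GroupLieAlgebra 𝓘(ℝ, E) G) : Ad (g * h) v = Ad g (Ad h v) := by
  have key := mfderiv_comp_apply_model (f := fun k : G => h * k * h⁻¹)
    (g := fun k : G => g * k * g⁻¹) (x := 1) (y := 1)
    ((contMDiff_conj (E := E) g).mdifferentiable (by simp) _)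
    ((contMDiff_conj (E := E) h).mdifferentiable (by simp) _) (by simp) v
  have hfun : (fun k : G => g * h * k * (g * h)⁻¹) = fun k => g * (h * k * h⁻¹) * g⁻¹ := by
    ext k; group
  unfold Ad
  rw [hfun]
  exact key

/-- The adjoint representation on the model space. -/
noncomputable def adRep : G →* Module.End ℝ E where
  toFun g :=
    { toFun := fun v => (Ad g v : E)
      map_add' := fun v w => (Ad (E := E) g).map_add v w
      map_smul' := fun c v => (Ad (E := E) g).map_smul c v }
  map_one' := by
    ext v
    exact congrArg (fun D : GroupLieAlgebra 𝓘(ℝ, E) G →L[ℝ] GroupLieAlgebra 𝓘(ℝ, E) G => D v)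
      Ad_one
  map_mul' g h := by
    ext v
    exact Ad_mul g h v

/-- Conjugation is jointly smooth in both variables, so its derivative at 1 depends differentiably
on `g`. Since conjugation fixes 1, the tangent coordinate changes involved are identities. -/
theorem contMDiff_adRep_apply (v : E) :
    ContMDiff 𝓘(ℝ, E) 𝓘(ℝ, E) 1 fun g : G => adRep g v := by
  intro g₀
  have : IsManifold 𝓘(ℝ, E) 1 G := IsManifold.of_le (n := ∞) (by simp)
  have hf : ContMDiff (𝓘(ℝ, E).prod 𝓘(ℝ, E)) 𝓘(ℝ, E) ∞
      (Function.uncurry fun g h : G => g * h * g⁻¹) :=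
    (contMDiff_fst.mul contMDiff_snd).mul contMDiff_fst.inv
  have key := ContMDiffAt.mfderiv_apply (I := 𝓘(ℝ, E)) (I' := 𝓘(ℝ, E)) (m := 1) (n := ∞) (x₀ := g₀)
    (fun g h : G => g * h * g⁻¹) (fun _ => 1) id (fun _ => v) hf.contMDiffAt contMDiffAt_const
    contMDiffAt_id contMDiffAt_const (by norm_cast)
  refine key.congr_of_eventuallyEq (Eventually.of_forall fun g => ?_)
  have hone : ∀ g : G, g * 1 * g⁻¹ = 1 := fun g => by simp
  have hcc : ∀ a b : G, a = 1 → b = 1 → ∀ w : E,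
      (tangentBundleCore 𝓘(ℝ, E) G).coordChange (achart E a) (achart E b) a w = w := by
    rintro _ _ rfl rfl w
    exact (tangentBundleCore 𝓘(ℝ, E) G).coordChange_self _ _ (mem_achart_source E (1 : G)) w
  have hcoord := inTangentCoordinates_eq (I := 𝓘(ℝ, E)) (I' := 𝓘(ℝ, E)) (fun _ : G => (1 : G))
    (fun g : G => g * 1 * g⁻¹)
    (fun g : G => (mfderiv 𝓘(ℝ, E) 𝓘(ℝ, E) (fun h => g * h * g⁻¹) 1 : E →L[ℝ] E))
    (x₀ := g₀) (x := g)
    (mem_chart_source _ _) (by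
      simp only [hone]
      exact mem_chart_source _ _)
  refine Eq.trans ?_ (congrArg (fun D : E →L[ℝ] E => D v) hcoord).symm
  exact ((hcc _ _ (hone g) (hone g₀) _).trans
    (congrArg (fun w => adRep g w) (hcc 1 1 rfl rfl v))).symm

variable [FiniteDimensional ℝ E]

/-- The derivative of the adjoint representation is the bracket. -/
theorem mfderiv_adRep_apply (x y : E) :
    (mfderiv 𝓘(ℝ, E) 𝓘(ℝ, E) (fun g : G => adRep g y) 1 x : E) =
      @Bracket.bracket (GroupLieAlgebra 𝓘(ℝ, E) G) (GroupLieAlgebra 𝓘(ℝ, E) G) _ x y := by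
  have := FiniteDimensional.complete ℝ E
  have hman : IsManifold 𝓘(ℝ, E) 1 G := IsManifold.of_le (n := ∞) (by simp)
  set φ := extChartAt 𝓘(ℝ, E) (1 : G) with hφ
  set e : E := φ 1 with he
  have hφ1 : φ.symm e = 1 := extChartAt_to_inv (1 : G)
  have het : e ∈ φ.target := mem_extChartAt_target 1
  have htgt : φ.target ∈ 𝓝 e := extChartAt_target_mem_nhds (1 : G)
  have hsrc : φ.source ∈ 𝓝 (1 : G) := extChartAt_source_mem_nhds 1
  have hφd : MDifferentiableAt 𝓘(ℝ, E) 𝓘(ℝ, E) φ 1 :=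
    mdifferentiableAt_extChartAt (mem_chart_source E 1)
  have hφid : ∀ v : E, (mfderiv 𝓘(ℝ, E) 𝓘(ℝ, E) φ 1 v : E) = v := fun v =>
    congrArg (fun D : E →L[ℝ] E => D v) mfderiv_extChartAt_self
  have hsymm : ContMDiffAt 𝓘(ℝ, E) 𝓘(ℝ, E) ∞ φ.symm e :=
    (contMDiffOn_extChartAt_symm (1 : G)).contMDiffAt htgt
  -- Everything is computed from the second derivative at `(e, e)` of the multiplication read in the
  -- chart at 1.
  set m : E × E → E := fun q => φ (φ.symm q.1 * φ.symm q.2) with hm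
  have hmsm : ContDiffAt ℝ ∞ m (e, e) := by
    have h1 : ContMDiffAt 𝓘(ℝ, E × E) 𝓘(ℝ, E) ∞ (fun q : E × E => φ.symm q.1 * φ.symm q.2)
        (e, e) :=
      (hsymm.comp (e, e) contDiff_fst.contMDiff.contMDiffAt).mul
        (hsymm.comp (e, e) contDiff_snd.contMDiff.contMDiffAt)
    have h2 : ContMDiffAt 𝓘(ℝ, E) 𝓘(ℝ, E) ∞ φ (φ.symm e * φ.symm e) := by
      rw [hφ1, mul_one]
      exact contMDiffAt_extChartAt
    exact (ContMDiffAt.comp (g := φ) (e, e) h2 h1).contDiffAt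
  have hmd : ∀ᶠ q in 𝓝 (e, e), DifferentiableAt ℝ m q :=
    ((hmsm.of_le (by simp : (1 : WithTop ℕ∞) ≤ ∞)).eventually (by simp)).mono
      fun q hq => hq.differentiableAt one_ne_zero
  have hd2 : HasFDerivAt (fderiv ℝ m) (fderiv ℝ (fderiv ℝ m) (e, e)) (e, e) :=
    ((hmsm.fderiv_right (m := 1) (by norm_cast)).differentiableAt one_ne_zero).hasFDerivAt
  have hinl : HasFDerivAt (fun a : E => (a, e)) (ContinuousLinearMap.inl ℝ E E) e :=
    hasFDerivAt_prodMk_left e e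
  have hinr : HasFDerivAt (fun a : E => (e, a)) (ContinuousLinearMap.inr ℝ E E) e :=
    hasFDerivAt_prodMk_right e e
  have hml : ∀ a ∈ φ.target, m (a, e) = a := fun a ha => by
    simp only [hm]
    rw [hφ1, mul_one, φ.right_inv ha]
  -- The left-invariant vector field with value `v` at 1, read in the chart.
  set P : E → E → E := fun v a => fderiv ℝ m (a, e) (0, v) with hP
  -- the left translation by `φ.symm a`, read in the chart
  set T : E → G → E := fun a h => φ (φ.symm a * h) with hT
  have hTP : ∀ᶠ a in 𝓝 e, ∀ v : E, (mfderiv 𝓘(ℝ, E) 𝓘(ℝ, E) (T a) 1 v : E) = P v a := by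
    filter_upwards [htgt, hinl.continuousAt.eventually hmd] with a ha hda v
    have hr : HasFDerivAt (fun b : E => m (a, b))
        ((fderiv ℝ m (a, e)).comp (ContinuousLinearMap.inr ℝ E E)) e :=
      HasFDerivAt.comp (f := fun b : E => (a, b)) e hda.hasFDerivAt (hasFDerivAt_prodMk_right a e)
    have hev : T a =ᶠ[𝓝 1] fun h => m (a, φ h) := by
      filter_upwards [hsrc] with h hh
      simp only [hT, hm]
      rw [φ.left_inv hh]
    rw [hev.mfderiv_eq]
    refine (mfderiv_comp_apply_model (g := fun b : E => m (a, b)) (f := φ) (y := e)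
      hr.differentiableAt.mdifferentiableAt hφd rfl v).trans ?_
    rw [hφid, mfderiv_eq_fderiv, hr.fderiv]
    rfl
  have hTV : ∀ a ∈ φ.target, ∀ v : E, (mfderiv 𝓘(ℝ, E) 𝓘(ℝ, E) (T a) 1 v : E) =
      (mfderiv 𝓘(ℝ, E) 𝓘(ℝ, E) φ (φ.symm a) (mulInvariantVectorField v (φ.symm a) : E) : E) := by
    intro a ha v
    have hg : MDifferentiableAt 𝓘(ℝ, E) 𝓘(ℝ, E) φ (φ.symm a) :=
      mdifferentiableAt_extChartAt (by
        rw [← extChartAt_source 𝓘(ℝ, E)]; exact φ.map_target ha)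
    exact mfderiv_comp_apply_model (g := φ) (f := fun h => φ.symm a * h) hg
      ((contMDiff_mul_left (I := 𝓘(ℝ, E)) (n := ∞)).mdifferentiable (by simp) _) (mul_one _) v
  -- Left translation is rewritten by g h = (g h g⁻¹) g, which brings Ad into the formula.
  have hTA : ∀ᶠ a in 𝓝 e, ∀ v : E, (mfderiv 𝓘(ℝ, E) 𝓘(ℝ, E) (T a) 1 v : E) =
      fderiv ℝ m (e, a) (adRep (φ.symm a) v, 0) := by
    filter_upwards [htgt, hinr.continuousAt.eventually hmd] with a ha hda v
    have hl : HasFDerivAt (fun b : E => m (b, a))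
        ((fderiv ℝ m (e, a)).comp (ContinuousLinearMap.inl ℝ E E)) e :=
      HasFDerivAt.comp (f := fun b : E => (b, a)) e hda.hasFDerivAt (hasFDerivAt_prodMk_left e a)
    set g := φ.symm a with hg
    have hc1 : g * 1 * g⁻¹ = 1 := by simp
    have hcd := (contMDiff_conj (E := E) g).mdifferentiable (by simp) 1
    have hcsrc : ∀ᶠ h in 𝓝 (1 : G), g * h * g⁻¹ ∈ φ.source :=
      hcd.continuousAt.eventually_mem (by rw [hc1]; exact hsrc)
    have hev : T a =ᶠ[𝓝 1] fun h => m (φ (g * h * g⁻¹), a) := by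
      filter_upwards [hcsrc] with h hh
      simp only [hT, hm]
      rw [φ.left_inv hh, ← hg, inv_mul_cancel_right]
    rw [hev.mfderiv_eq]
    have hφc : MDifferentiableAt 𝓘(ℝ, E) 𝓘(ℝ, E) (fun h => φ (g * h * g⁻¹)) 1 :=
      MDifferentiableAt.comp (g := φ) (1 : G) (by rw [hc1]; exact hφd) hcd
    refine (mfderiv_comp_apply_model (g := fun b : E => m (b, a))
      (f := fun h : G => φ (g * h * g⁻¹)) (y := e)
      hl.differentiableAt.mdifferentiableAt hφc (by rw [hc1]) v).trans ?_
    have h1 : (mfderiv 𝓘(ℝ, E) 𝓘(ℝ, E) (fun h : G => φ (g * h * g⁻¹)) 1 v : E) = adRep g v :=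
      (mfderiv_comp_apply_model (g := φ) (f := fun h : G => g * h * g⁻¹) hφd hcd hc1 v).trans
        (hφid _)
    have h2 : ∀ w : E, (mfderiv 𝓘(ℝ, E) 𝓘(ℝ, E) (fun b : E => m (b, a)) e w : E) =
        fderiv ℝ m (e, a) (w, 0) := fun w => by
      rw [mfderiv_eq_fderiv, hl.fderiv]
      rfl
    exact (h2 _).trans (congrArg (fun w : E => fderiv ℝ m (e, a) (w, 0)) h1)
  have hPe : ∀ v, P v e = v := fun v => by
    have h0 := hTP.self_of_nhds v
    rw [hTV e het v, hφ1] at h0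
    refine ((hφid _).symm.trans h0).symm.trans ?_
    have hid : (fun h : G => 1 * h) = id := by ext; simp
    unfold mulInvariantVectorField
    rw [hid]
    exact congrArg (fun D : E →L[ℝ] E => D v) mfderiv_id
  have hPd : ∀ v w, fderiv ℝ (P v) e w = fderiv ℝ (fderiv ℝ m) (e, e) (w, 0) (0, v) := by
    intro v w
    have h1 := (HasFDerivAt.comp (f := fun a : E => (a, e)) e hd2 hinl).clm_apply
      (hasFDerivAt_const ((0, v) : E × E) e)
    rw [show fderiv ℝ (P v) e = _ from h1.fderiv]
    simp
  have hpull : ∀ v : E, VectorField.mpullbackWithin 𝓘(ℝ, E) 𝓘(ℝ, E) φ.symm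
      (mulInvariantVectorField v) (Set.range 𝓘(ℝ, E)) =ᶠ[𝓝 e] P v := by
    intro v
    filter_upwards [htgt, hTP] with a ha h1
    rw [VectorField.mpullbackWithin_apply]
    have hinv := ContinuousLinearMap.inverse_eq
      (mfderivWithin_extChartAt_symm_comp_mfderiv_extChartAt ha)
      (mfderiv_extChartAt_comp_mfderivWithin_extChartAt_symm ha)
    rw [hinv, ← h1 v, hTV a ha v]
    rfl
  have hbr : @Bracket.bracket (GroupLieAlgebra 𝓘(ℝ, E) G) (GroupLieAlgebra 𝓘(ℝ, E) G) _ x y =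
      fderiv ℝ (fderiv ℝ m) (e, e) (x, 0) (0, y) -
      fderiv ℝ (fderiv ℝ m) (e, e) (y, 0) (0, x) := by
    have h0 := VectorField.mlieBracketWithin_apply (I := 𝓘(ℝ, E))
      (V := mulInvariantVectorField (I := 𝓘(ℝ, E)) (G := G) x)
      (W := mulInvariantVectorField (I := 𝓘(ℝ, E)) (G := G) y)
      (s := Set.univ) (x₀ := (1 : G))
    have hinv : ∀ w : E, ((mfderiv 𝓘(ℝ, E) 𝓘(ℝ, E) φ 1 : E →L[ℝ] E).inverse w : E) = w := by
      intro w
      rw [show (mfderiv 𝓘(ℝ, E) 𝓘(ℝ, E) φ 1 : E →L[ℝ] E) = ContinuousLinearMap.id ℝ E from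
        mfderiv_extChartAt_self]
      exact congrArg (fun D : E →L[ℝ] E => D w)
        (ContinuousLinearMap.inverse_id : (ContinuousLinearMap.id ℝ E).inverse = _)
    refine Eq.trans h0 ((hinv _).trans ?_)
    have h1 := hpull x
    have h2 := hpull y
    simp only [modelWithCornersSelf_coe, Set.range_id] at h1 h2
    simp only [Set.preimage_univ, Set.univ_inter, modelWithCornersSelf_coe, Set.range_id]
    refine (congrFun (VectorField.lieBracketWithin_univ (𝕜 := ℝ) (E := E)) e).trans ?_
    refine (Filter.EventuallyEq.lieBracket_vectorField_eq h1 h2).trans ?_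
    rw [VectorField.lieBracket, hPe, hPe, hPd, hPd]
  set A : E → E := fun a => adRep (φ.symm a) y with hA
  have hAd : DifferentiableAt ℝ A e := by
    have : ContMDiffAt 𝓘(ℝ, E) 𝓘(ℝ, E) 1 A e :=
      (contMDiff_adRep_apply (G := G) y).contMDiffAt.comp e (hsymm.of_le (by simp))
    exact this.contDiffAt.differentiableAt one_ne_zero
  have hAe : A e = y := by
    simp only [hA, hφ1, map_one]
    rfl
  have hderA : (mfderiv 𝓘(ℝ, E) 𝓘(ℝ, E) (fun g : G => adRep g y) 1 x : E) = fderiv ℝ A e x := by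
    have hev : (fun g : G => adRep g y) =ᶠ[𝓝 1] fun g => A (φ g) := by
      filter_upwards [hsrc] with g hg
      simp only [hA]
      rw [φ.left_inv hg]
    rw [hev.mfderiv_eq]
    refine (mfderiv_comp_apply_model (g := A) (f := φ) (y := e) hAd.mdifferentiableAt hφd rfl
      x).trans ?_
    rw [hφid, mfderiv_eq_fderiv]
    rfl
  -- Equating the two expressions for the derivative of left translation and differentiating at `e`
  -- leaves the derivative of Ad as a difference of mixed second derivatives; symmetry of the second
  -- derivative identifies it with the bracket.
  have hrel : P y =ᶠ[𝓝 e] fun a => fderiv ℝ m (e, a) (A a, 0) := by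
    filter_upwards [hTP, hTA] with a h1 h2
    exact (h1 y).symm.trans (h2 y)
  have hA0 : HasFDerivAt (fun a => (A a, (0 : E)))
      ((ContinuousLinearMap.inl ℝ E E).comp (fderiv ℝ A e)) e :=
    (ContinuousLinearMap.inl ℝ E E).hasFDerivAt.comp e hAd.hasFDerivAt
  have hR := (HasFDerivAt.comp (f := fun a : E => (e, a)) e hd2 hinr).clm_apply hA0
  have hinlid : fderiv ℝ m (e, e) (fderiv ℝ A e x, 0) = fderiv ℝ A e x := by
    have h1 : HasFDerivAt (fun a => m (a, e))
        ((fderiv ℝ m (e, e)).comp (ContinuousLinearMap.inl ℝ E E)) e :=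
      HasFDerivAt.comp (f := fun a : E => (a, e)) e hmd.self_of_nhds.hasFDerivAt hinl
    have h2 : (fun a => m (a, e)) =ᶠ[𝓝 e] id := by
      filter_upwards [htgt] with a ha using hml a ha
    have h3 := h1.unique ((hasFDerivAt_id e).congr_of_eventuallyEq h2)
    exact DFunLike.congr_fun h3 _
  have hfin : fderiv ℝ (P y) e x = fderiv ℝ (fderiv ℝ m) (e, e) (0, x) (y, 0) + fderiv ℝ A e x := by
    rw [hrel.fderiv_eq, show fderiv ℝ (fun a => fderiv ℝ m (e, a) (A a, 0)) e = _ from hR.fderiv]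
    refine Eq.trans (b := fderiv ℝ m (e, e) (fderiv ℝ A e x, 0) +
      fderiv ℝ (fderiv ℝ m) (e, e) (0, x) (A e, 0)) rfl ?_
    rw [hinlid, hAe, add_comm]
  have hsym : IsSymmSndFDerivAt ℝ m (e, e) := hmsm.isSymmSndFDerivAt (by
    rw [minSmoothness_of_isRCLikeNormedField]; exact WithTop.coe_le_coe.2 le_top)
  rw [hderA, hbr, ← hPd y x, hfin, hsym (0, x) (y, 0)]
  abel

end AdjointRepresentation

/-! ### Generic constancy of ranks of polynomial families -/

section PolynomialGenericity

variable {V : Type*} [NormedAddCommGroup V] [NormedSpace ℝ V] [FiniteDimensional ℝ V]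

theorem fderiv_apply_mem_polyFun {f : V → ℝ} (hf : f ∈ polyFun V) (v : V) :
    (fun x => fderiv ℝ f x v) ∈ polyFun V := by
  induction hf using Algebra.adjoin_induction with
  | mem f hf =>
    obtain ⟨φ, rfl⟩ := hf
    have : (fun x => fderiv ℝ (fun v => φ v) x v) = algebraMap ℝ (V → ℝ) (φ v) := by
      ext x
      rw [show fderiv ℝ (fun v => φ v) x = _ from (LinearMap.toContinuousLinearMap φ).fderiv]
      rfl
    rw [this]
    exact algebraMap_mem _ _
  | algebraMap r =>
    have : (fun x => fderiv ℝ (algebraMap ℝ (V → ℝ) r) x v) = 0 := by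
      ext x
      rw [show fderiv ℝ (algebraMap ℝ (V → ℝ) r) x = 0 from congrFun (fderiv_const r) x]
      rfl
    rw [this]
    exact zero_mem _
  | add f g hf hg hf' hg' =>
    have : (fun x => fderiv ℝ (f + g) x v) =
        (fun x => fderiv ℝ f x v) + fun x => fderiv ℝ g x v := by
      ext x
      rw [fderiv_add ((contDiff_of_mem_polyFun hf).differentiable one_ne_zero x)
        ((contDiff_of_mem_polyFun hg).differentiable one_ne_zero x)]
      rfl
    rw [this]
    exact add_mem hf' hg'
  | mul f g hf hg hf' hg' =>
    have : (fun x => fderiv ℝ (f * g) x v) =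
        f * (fun x => fderiv ℝ g x v) + g * fun x => fderiv ℝ f x v := by
      ext x
      rw [fderiv_mul ((contDiff_of_mem_polyFun hf).differentiable one_ne_zero x)
        ((contDiff_of_mem_polyFun hg).differentiable one_ne_zero x)]
      rfl
    rw [this]
    exact add_mem (mul_mem hf hg') (mul_mem hg hf')

/-- The restriction of a polynomial function to a line is a polynomial. -/
theorem exists_polynomial_eval_eq_of_mem_polyFun {V : Type*} [AddCommGroup V] [Module ℝ V]
    {f : V → ℝ} (hf : f ∈ polyFun V) (x w : V) :
    ∃ P : Polynomial ℝ, ∀ t : ℝ, f (x + t • w) = P.eval t := by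
  induction hf using Algebra.adjoin_induction with
  | mem f hf =>
    obtain ⟨φ, rfl⟩ := hf
    exact ⟨Polynomial.C (φ x) + Polynomial.X * Polynomial.C (φ w), fun t => by
      simp only [map_add, map_smul, smul_eq_mul, Polynomial.eval_add, Polynomial.eval_mul,
        Polynomial.eval_C, Polynomial.eval_X]⟩
  | algebraMap r => exact ⟨Polynomial.C r, fun t => by simp⟩
  | add f g _ _ hf hg =>
    obtain ⟨P, hP⟩ := hf
    obtain ⟨Q, hQ⟩ := hg
    exact ⟨P + Q, fun t => by simp [hP, hQ]⟩
  | mul f g _ _ hf hg =>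
    obtain ⟨P, hP⟩ := hf
    obtain ⟨Q, hQ⟩ := hg
    exact ⟨P * Q, fun t => by simp [hP, hQ]⟩

/-- On the line from any point to `y` the function is a nonzero one-variable polynomial, so its
zeros there are finite in number and cannot fill a neighbourhood. -/
theorem dense_setOf_ne_zero_of_mem_polyFun {V : Type*} [NormedAddCommGroup V] [NormedSpace ℝ V]
    {f : V → ℝ} (hf : f ∈ polyFun V) {y : V}
    (hy : f y ≠ 0) : Dense {x | f x ≠ 0} := by
  rw [dense_iff_inter_open]
  rintro U hU ⟨x, hx⟩
  obtain ⟨P, hP⟩ := exists_polynomial_eval_eq_of_mem_polyFun hf x (y - x)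
  have hP0 : P ≠ 0 := by
    rintro rfl
    have := hP 1
    simp at this
    exact hy this
  have hc : Continuous fun t : ℝ => x + t • (y - x) := by fun_prop
  have hmem : (fun t : ℝ => x + t • (y - x)) ⁻¹' U ∈ 𝓝 (0 : ℝ) :=
    (hU.preimage hc).mem_nhds (by simpa using hx)
  have hinf := infinite_of_mem_nhds (0 : ℝ) hmem
  obtain ⟨t, ht, htP⟩ := (hinf.sdiff (Polynomial.finite_setOfPred_isRoot hP0)).nonempty
  exact ⟨_, ht, by rw [Set.mem_ofPred_eq, hP]; exact htP⟩

/-- The span of the values of a family of polynomial vector fields has constant dimension on an open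
dense set. -/
theorem exists_isOpen_dense_finrank_span_eq {ι : Type*} (v : ι → V → V)
    (hv : ∀ i, ∀ φ : Module.Dual ℝ V, (fun x => φ (v i x)) ∈ polyFun V) :
    ∃ (U : Set V) (r : ℕ), IsOpen U ∧ Dense U ∧
      ∀ x ∈ U, Module.finrank ℝ (Submodule.span ℝ (Set.range fun i => v i x)) = r := by
  obtain ⟨y, -, hmax⟩ := exists_forall_le_of_forall_le (s := (Set.univ : Set V)) ⟨0, trivial⟩
    (fun x => Module.finrank ℝ (Submodule.span ℝ (Set.range fun i => v i x)))
    (fun x _ => Submodule.finrank_le _)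
  obtain ⟨κ, a, -, hspan, hli⟩ := exists_linearIndependent' ℝ fun i => v i y
  have := hli.finite
  have := Fintype.ofFinite κ
  classical
  have hinj : LinearMap.ker (Fintype.linearCombination ℝ ((fun i => v i y) ∘ a)) = ⊥ :=
    LinearMap.ker_eq_bot.2 (linearIndependent_iff_injective_fintypeLinearCombination.1 hli)
  obtain ⟨g, hg⟩ := LinearMap.exists_leftInverse_of_injective _ hinj
  -- A left inverse of the basis map at `y` gives a square matrix with polynomial entries that is
  -- the identity at `y`; wherever its determinant is nonzero the maximal rank is attained.
  set M : V → Matrix κ κ ℝ := fun x => Matrix.of fun k l => g (v (a l) x) k with hM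
  have hD : (fun x => (M x).det) ∈ polyFun V := by
    have : (fun x => (M x).det) = ∑ σ : Equiv.Perm κ, (Equiv.Perm.sign σ : ℤ) •
        ∏ k, fun x => ((LinearMap.proj (σ k)).comp g) (v (a k) x) := by
      ext x
      rw [Matrix.det_apply]
      simp [hM, Units.smul_def]
    rw [this]
    exact sum_mem fun σ _ => zsmul_mem (prod_mem fun k _ => hv _ _) _
  have hMy : M y = 1 := by
    ext k l
    have := congrFun (LinearMap.congr_fun hg (Pi.single l 1)) k
    simp only [LinearMap.comp_apply, LinearMap.id_apply, Fintype.linearCombination_apply_single,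
      one_smul, Function.comp_apply] at this
    change g (v (a l) y) k = _
    rw [this, Matrix.one_apply, Pi.single_apply]
  refine ⟨{x | (M x).det ≠ 0}, _, ?_, dense_setOf_ne_zero_of_mem_polyFun hD (y := y) ?_,
    fun x hx => le_antisymm (hmax x trivial) ?_⟩
  · exact isOpen_ne_fun (continuous_of_mem_polyFun hD) continuous_const
  · rw [hMy, Matrix.det_one]
    exact one_ne_zero
  · have hlix : LinearIndependent ℝ fun k => v (a k) x := by
      rw [Fintype.linearIndependent_iff]
      intro c hc
      have : (M x).mulVec c = 0 := by
        ext k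
        have := congrFun (congrArg g hc) k
        simp only [map_sum, map_smul, Finset.sum_apply, Pi.smul_apply, smul_eq_mul, map_zero,
          Pi.zero_apply] at this
        rw [Matrix.mulVec, dotProduct, Pi.zero_apply, ← this]
        exact Finset.sum_congr rfl fun l _ => mul_comm _ _
      exact congrFun (Matrix.eq_zero_of_mulVec_eq_zero hx this)
    have h1 : Module.finrank ℝ (Submodule.span ℝ (Set.range fun i => v i y)) = Fintype.card κ := by
      rw [← (LinearEquiv.ofEq _ _ hspan).finrank_eq]
      exact finrank_span_eq_card hli
    have h2 := finrank_span_eq_card hlix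
    rw [h1, ← h2]
    exact Submodule.finrank_mono (Submodule.span_mono (by rintro _ ⟨k, rfl⟩; exact ⟨a k, rfl⟩))

end PolynomialGenericity

/-! ### Linear algebra of degenerate reflexive forms -/

section SkewForms

open Module

variable {V : Type*} [AddCommGroup V] [Module ℝ V]
  {Λ : LinearMap.BilinForm ℝ V}

/-- Translates dimensions in the cotangent space 𝔤/ker Λ of an orbit into dimensions in 𝔤. -/
theorem finrank_map_mkQ_add_finrank [FiniteDimensional ℝ V] {Z S : Submodule ℝ V} (h : Z ≤ S) :
    finrank ℝ (S.map Z.mkQ) + finrank ℝ Z = finrank ℝ S := by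
  have h1 := (Z.mkQ.domRestrict S).finrank_range_add_finrank_ker
  rw [LinearMap.range_domRestrict] at h1
  have h2 : LinearMap.ker (Z.mkQ.domRestrict S) = Z.comap S.subtype := by
    rw [LinearMap.ker_domRestrict, Submodule.ker_mkQ]
  rw [h2, (Submodule.comapSubtypeEquivOfLe h).finrank_eq] at h1
  exact h1

theorem LinearMap.BilinForm.orthogonal_top_le (k : Submodule ℝ V) :
    Λ.orthogonal ⊤ ≤ Λ.orthogonal k :=
  LinearMap.BilinForm.orthogonal_le le_top

namespace LinearMap.BilinForm.IsRefl

/-- Vectors of the radical pair to zero with everything, so adding them imposes no new condition. -/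
theorem orthogonal_orthogonal_top_sup (hΛ : Λ.IsRefl) (k : Submodule ℝ V) :
    Λ.orthogonal (Λ.orthogonal ⊤ ⊔ k) = Λ.orthogonal k := by
  refine le_antisymm (LinearMap.BilinForm.orthogonal_le le_sup_right) fun x hx => ?_
  intro y hy
  obtain ⟨a, ha, b, hb, rfl⟩ := Submodule.mem_sup.1 hy
  have h1 : Λ x a = 0 := ha x trivial
  have h2 : Λ b x = 0 := hx b hb
  change Λ (a + b) x = 0
  rw [map_add, LinearMap.add_apply, h2, hΛ _ _ h1, add_zero]

variable [FiniteDimensional ℝ V]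

theorem finrank_sup_add_finrank_orthogonal (hΛ : Λ.IsRefl) (k : Submodule ℝ V) :
    finrank ℝ ↥(Λ.orthogonal ⊤ ⊔ k) + finrank ℝ (Λ.orthogonal k) =
      finrank ℝ V + finrank ℝ (Λ.orthogonal ⊤) := by
  have h := LinearMap.BilinForm.finrank_add_finrank_orthogonal hΛ (Λ.orthogonal ⊤ ⊔ k)
  rwa [hΛ.orthogonal_orthogonal_top_sup, inf_eq_right.2 le_sup_left] at h

/-- One inclusion is formal once the radical is absorbed; the other follows by comparing dimension
formulas for `k` and for its orthogonal, which contains the radical. -/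
theorem orthogonal_orthogonal_eq_sup (hΛ : Λ.IsRefl) (k : Submodule ℝ V) :
    Λ.orthogonal (Λ.orthogonal k) = Λ.orthogonal ⊤ ⊔ k := by
  have h1 := hΛ.finrank_sup_add_finrank_orthogonal k
  have h2 := LinearMap.BilinForm.finrank_add_finrank_orthogonal hΛ (Λ.orthogonal k)
  rw [inf_eq_right.2 (orthogonal_top_le k)] at h2
  refine (Submodule.eq_of_le_of_finrank_le ?_ (by omega)).symm
  rw [← hΛ.orthogonal_orthogonal_top_sup k]
  exact LinearMap.BilinForm.le_orthogonal_orthogonal hΛ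

/-- Adjoining to `ker Λ + k` a vector outside of it that is orthogonal to `k` and to itself
increases both the dimension and the dimension of the kernel of the restricted form by one. -/
theorem finrank_sup_span_singleton (hΛ : Λ.IsRefl) {k : Submodule ℝ V} {g : V}
    (hg : g ∈ Λ.orthogonal k) (hgg : Λ g g = 0)
    (hgW : g ∉ Λ.orthogonal ⊤ ⊔ k) :
    finrank ℝ ↥((Λ.orthogonal ⊤ ⊔ k) ⊔ ℝ ∙ g) = finrank ℝ ↥(Λ.orthogonal ⊤ ⊔ k) + 1 ∧
    finrank ℝ ↥(((Λ.orthogonal ⊤ ⊔ k) ⊔ ℝ ∙ g) ⊓ Λ.orthogonal ((Λ.orthogonal ⊤ ⊔ k) ⊔ ℝ ∙ g)) =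
      finrank ℝ ↥(Λ.orthogonal k ⊓ (Λ.orthogonal ⊤ ⊔ k)) + 1 := by
  set W := Λ.orthogonal ⊤ ⊔ k with hW
  have hg0 : g ≠ 0 := by rintro rfl; exact hgW (zero_mem _)
  have hadd : ∀ S ≤ W, finrank ℝ ↥(S ⊔ ℝ ∙ g) = finrank ℝ S + 1 := by
    intro S hS
    have h1 := Submodule.finrank_sup_add_finrank_inf_eq S (ℝ ∙ g)
    have h2 : S ⊓ ℝ ∙ g = ⊥ := by
      rw [← disjoint_iff, Submodule.disjoint_span_singleton' hg0]
      exact fun h => hgW (hS h)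
    rw [h2, finrank_bot, finrank_span_singleton hg0] at h1
    exact h1
  have hgW' : ∀ w ∈ W, Λ w g = 0 := by
    have : g ∈ Λ.orthogonal W := by rw [hW, hΛ.orthogonal_orthogonal_top_sup]; exact hg
    exact this
  refine ⟨hadd W le_rfl, ?_⟩
  rw [← hadd _ inf_le_right]
  refine congrArg (fun S : Submodule ℝ V => finrank ℝ S) (le_antisymm ?_ ?_)
  · rintro x ⟨hx1, hx2⟩
    obtain ⟨w, hw, c, hc, rfl⟩ := Submodule.mem_sup.1 hx1
    refine Submodule.add_mem_sup ⟨?_, hw⟩ hc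
    intro y hy
    have h1 : Λ y (w + c) = 0 := hx2 y (Submodule.mem_sup_left (Submodule.mem_sup_right hy))
    obtain ⟨t, rfl⟩ := Submodule.mem_span_singleton.1 hc
    rw [map_add, map_smul, show Λ y g = 0 from hg y hy, smul_zero, add_zero] at h1
    exact h1
  · refine sup_le ?_ ?_
    · rintro x ⟨hx1, hx2⟩
      refine ⟨Submodule.mem_sup_left hx2, fun y hy => ?_⟩
      rw [← hΛ.orthogonal_orthogonal_top_sup, ← hW] at hx1
      obtain ⟨w, hw, c, hc, rfl⟩ := Submodule.mem_sup.1 hy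
      obtain ⟨t, rfl⟩ := Submodule.mem_span_singleton.1 hc
      change Λ (w + t • g) x = 0
      rw [map_add, map_smul, LinearMap.add_apply, LinearMap.smul_apply,
        show Λ w x = 0 from hx1 w hw, hΛ _ _ (hgW' x hx2), smul_zero, add_zero]
    · rw [Submodule.span_singleton_le_iff_mem]
      refine ⟨Submodule.mem_sup_right (Submodule.mem_span_singleton_self g), fun y hy => ?_⟩
      obtain ⟨w, hw, c, hc, rfl⟩ := Submodule.mem_sup.1 hy
      obtain ⟨t, rfl⟩ := Submodule.mem_span_singleton.1 hc
      change Λ (w + t • g) g = 0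
      rw [map_add, map_smul, LinearMap.add_apply, LinearMap.smul_apply, hgW' w hw, hgg, smul_zero,
        add_zero]

end LinearMap.BilinForm.IsRefl

end SkewForms

/-! ### Gradients, and spans of gradients of generated algebras -/

namespace ScalarProduct

section Gradients

variable {V : Type*} [AddCommGroup V] [Module ℝ V] (B : ScalarProduct V)

theorem eq_of_forall_form_eq {a b : V} (h : ∀ v, B.form a v = B.form b v) : a = b := by
  refine sub_eq_zero.1 (B.eq_zero_of_self ?_)
  rw [LinearMap.map_sub B.form, LinearMap.sub_apply, h, sub_self]

variable [FiniteDimensional ℝ V]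

theorem form_grad [TopologicalSpace V] (f : V → ℝ) (x v : V) :
    B.form (B.grad f x) v = fderiv ℝ f x v :=
  LinearMap.BilinForm.apply_toDual_symm_apply _ _

theorem gradSpan_mono [TopologicalSpace V] {A A' : Set (V → ℝ)} (h : A ⊆ A') (x : V) :
    B.gradSpan A x ≤ B.gradSpan A' x :=
  Submodule.span_mono (Set.image_mono h)

theorem gradSpan_union [TopologicalSpace V] (A A' : Set (V → ℝ)) (x : V) :
    B.gradSpan (A ∪ A') x = B.gradSpan A x ⊔ B.gradSpan A' x := by
  rw [gradSpan, Set.image_union, Submodule.span_union]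
  rfl

theorem gradSpan_singleton [TopologicalSpace V] (p : V → ℝ) (x : V) :
    B.gradSpan {p} x = Submodule.span ℝ {B.grad p x} := by
  rw [gradSpan, Set.image_singleton]

theorem grad_mem_gradSpan [TopologicalSpace V] {A : Set (V → ℝ)} {f : V → ℝ} (hf : f ∈ A) (x : V) :
    B.grad f x ∈ B.gradSpan A x :=
  Submodule.subset_span ⟨f, hf, rfl⟩

/-- The projection onto `W` along its orthogonal complement does not affect pairings with elements
of `W`. -/
theorem form_proj (W : Submodule ℝ V) (w : W) (v : V) : B.form w (B.proj W v) = B.form w v := by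
  have h : v - B.proj W v ∈ B.form.orthogonal W := by
    rw [← Submodule.projectionOnto_apply_eq_zero_iff (B.isCompl_orthogonal W), map_sub,
      Submodule.projectionOnto_apply_left]
    exact sub_self _
  have := h w w.2
  change B.form w (v - B.proj W v) = 0 at this
  rw [map_sub, sub_eq_zero] at this
  exact this.symm

/-- Every functional on `W` is the pairing with some `w` in `W`, and pairing with `w` does not see
the projection. These generators have constant gradient `w`, which makes the gradient span of the
lifted polynomials equal to `W`. -/
theorem liftedPoly_eq_adjoin (W : Submodule ℝ V) :
    B.liftedPoly W =
      Subalgebra.toSubmodule (Algebra.adjoin ℝ (Set.range fun (w : W) (v : V) => B.form w v)) := by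
  let c : (W → ℝ) →ₐ[ℝ] (V → ℝ) :=
    { toFun := fun q v => q (B.proj W v)
      map_one' := rfl
      map_mul' := fun _ _ => rfl
      map_zero' := rfl
      map_add' := fun _ _ => rfl
      commutes' := fun _ => rfl }
  have hc : B.liftedPoly W = Subalgebra.toSubmodule ((polyFun W).map c) := rfl
  rw [hc, polyFun, AlgHom.map_adjoin, ← Set.range_comp]
  congr 2
  have hB : ∀ (w : W) (v : V), B.form w v = (B.form w ∘ₗ W.subtype) (B.proj W v) :=
    fun w v => (B.form_proj W w v).symm
  ext f
  constructor
  · rintro ⟨φ, rfl⟩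
    let B' : ScalarProduct W :=
      { form := B.form.restrict W
        symm := fun x y => B.symm x y
        pos := fun x hx => B.pos x fun h => hx (Subtype.ext h) }
    obtain ⟨w, hw⟩ := (B'.form.toDual B'.nondegenerate).surjective φ
    refine ⟨w, ?_⟩
    ext v
    rw [← hw]
    exact hB w v
  · rintro ⟨w, rfl⟩
    exact ⟨B.form w ∘ₗ W.subtype, funext fun v => (hB w v).symm⟩

theorem liftedPoly_le_polyFun (W : Submodule ℝ V) :
    B.liftedPoly W ≤ Subalgebra.toSubmodule (polyFun V) := by
  rw [liftedPoly_eq_adjoin]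
  exact Algebra.adjoin_mono (by rintro _ ⟨w, rfl⟩; exact ⟨B.form w, rfl⟩)

end Gradients

section PolynomialGradients

variable {V : Type*} [NormedAddCommGroup V] [NormedSpace ℝ V] [FiniteDimensional ℝ V]
  (B : ScalarProduct V)

theorem grad_form (w x : V) : B.grad (fun v => B.form w v) x = w := by
  refine B.eq_of_forall_form_eq fun v => ?_
  rw [form_grad, show fderiv ℝ (fun v => B.form w v) x = _ from
    (LinearMap.toContinuousLinearMap (B.form w)).fderiv]
  rfl

/-- Passing to the generated algebra does not change the span of the gradients. -/
theorem gradSpan_adjoin {A : Set (V → ℝ)} (hA : A ⊆ polyFun V) (x : V) :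
    B.gradSpan (Algebra.adjoin ℝ A : Set (V → ℝ)) x = B.gradSpan A x := by
  refine le_antisymm ?_ (B.gradSpan_mono Algebra.subset_adjoin x)
  rw [gradSpan, Submodule.span_le]
  rintro _ ⟨f, hf, rfl⟩
  have hle : Algebra.adjoin ℝ A ≤ polyFun V := Algebra.adjoin_le hA
  change B.grad f x ∈ B.gradSpan A x
  induction hf using Algebra.adjoin_induction with
  | mem f hf => exact B.grad_mem_gradSpan hf x
  | algebraMap r =>
    have : B.grad (algebraMap ℝ (V → ℝ) r) x = 0 := B.eq_of_forall_form_eq fun v => by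
      rw [form_grad, show fderiv ℝ (algebraMap ℝ (V → ℝ) r) x = 0 from congrFun (fderiv_const r) x,
        map_zero]
      rfl
    rw [this]
    exact zero_mem _
  | add f g hf hg hf' hg' =>
    have : B.grad (f + g) x = B.grad f x + B.grad g x := B.eq_of_forall_form_eq fun v => by
      rw [map_add, LinearMap.add_apply, form_grad, form_grad, form_grad,
        fderiv_add ((contDiff_of_mem_polyFun (hle hf)).differentiable one_ne_zero x)
        ((contDiff_of_mem_polyFun (hle hg)).differentiable one_ne_zero x)]
      rfl
    rw [this]
    exact add_mem hf' hg'
  | mul f g hf hg hf' hg' =>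
    have : B.grad (f * g) x = f x • B.grad g x + g x • B.grad f x :=
      B.eq_of_forall_form_eq fun v => by
        rw [map_add, map_smul, map_smul, LinearMap.add_apply, LinearMap.smul_apply,
          LinearMap.smul_apply, form_grad, form_grad, form_grad,
          fderiv_mul ((contDiff_of_mem_polyFun (hle hf)).differentiable one_ne_zero x)
          ((contDiff_of_mem_polyFun (hle hg)).differentiable one_ne_zero x)]
        rfl
    rw [this]
    exact add_mem (Submodule.smul_mem _ _ hg') (Submodule.smul_mem _ _ hf')

theorem gradSpan_liftedPoly (W : Submodule ℝ V) (x : V) :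
    B.gradSpan (B.liftedPoly W : Set (V → ℝ)) x = W := by
  rw [liftedPoly_eq_adjoin]
  refine (B.gradSpan_adjoin ?_ x).trans ?_
  · rintro _ ⟨w, rfl⟩
    exact dual_mem_polyFun (B.form w)
  · rw [gradSpan, ← Set.range_comp]
    have : (fun f => B.grad f x) ∘ (fun (w : W) (v : V) => B.form w v) = Subtype.val :=
      funext fun w => B.grad_form w x
    rw [this, Subtype.range_coe]
    exact Submodule.span_eq W

theorem exists_isOpen_dense_finrank_gradSpan_eq {A : Set (V → ℝ)} (hA : A ⊆ polyFun V) :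
    ∃ (U : Set V) (r : ℕ), IsOpen U ∧ Dense U ∧
      ∀ x ∈ U, Module.finrank ℝ (B.gradSpan A x) = r := by
  obtain ⟨U, r, hU, hd, h⟩ := exists_isOpen_dense_finrank_span_eq
    (fun (f : A) x => B.grad (f : V → ℝ) x) fun f φ => by
      obtain ⟨u, rfl⟩ := (B.form.toDual B.nondegenerate).surjective φ
      have : (fun x => B.form.toDual B.nondegenerate u (B.grad (f : V → ℝ) x)) =
          fun x => fderiv ℝ (f : V → ℝ) x u := by
        ext x
        rw [LinearMap.BilinForm.toDual_def, B.symm, form_grad]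
      rw [this]
      exact fderiv_apply_mem_polyFun (hA f.2) u
  refine ⟨U, r, hU, hd, fun x hx => ?_⟩
  rw [gradSpan, Set.image_eq_range]
  exact h x hx

end PolynomialGradients

end ScalarProduct

namespace ScalarProduct

section LiePoisson

variable {L : Type*} [LieRing L] [LieAlgebra ℝ L] (B : ScalarProduct L)

theorem poissonTensor_apply (x a b : L) : B.poissonTensor x a b = -B.form x ⁅a, b⁆ := rfl

theorem poissonTensor_self (x a : L) : B.poissonTensor x a a = 0 := by
  rw [poissonTensor_apply, lie_self, map_zero, neg_zero]

theorem isRefl_poissonTensor (x : L) : (B.poissonTensor x).IsRefl := fun a b h => by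
  rw [poissonTensor_apply, ← lie_skew, map_neg, ← poissonTensor_apply, h, neg_zero]

theorem kerOn_top (x : L) : B.kerOn x ⊤ = (B.poissonTensor x).orthogonal ⊤ := top_inf_eq _

end LiePoisson

end ScalarProduct

/-! ### Infinitesimal consequences of Ad-invariance -/

section AdjointInvariance

theorem fderiv_mfderiv_eq_zero {E F H : Type*} [NormedAddCommGroup E] [NormedSpace ℝ E]
    [NormedAddCommGroup F] [NormedSpace ℝ F] [TopologicalSpace H] [ChartedSpace F H]
    {f : E → ℝ} {Φ : H → E} {x : H} {y : E} {c : ℝ}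
    (hf : DifferentiableAt ℝ f y) (hΦ : MDifferentiableAt 𝓘(ℝ, F) 𝓘(ℝ, E) Φ x) (hy : Φ x = y)
    (h : ∀ z, f (Φ z) = c) (w : F) :
    fderiv ℝ f y (mfderiv 𝓘(ℝ, F) 𝓘(ℝ, E) Φ x w : E) = 0 := by
  have h1 := mfderiv_comp_apply_model hf.mdifferentiableAt hΦ hy w
  have h2 : (fun z => f (Φ z)) = fun _ => c := funext h
  rw [mfderiv_eq_fderiv, h2, mfderiv_const] at h1
  exact h1.symm

variable {E : Type*} [NormedAddCommGroup E] [NormedSpace ℝ E] [FiniteDimensional ℝ E]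
  {G : Type*} [TopologicalSpace G] [ChartedSpace E G] [Group G] [LieGroup 𝓘(ℝ, E) ∞ G]
  {F : Type*} [NormedAddCommGroup F] [NormedSpace ℝ F]
  {H : Type*} [TopologicalSpace H] [ChartedSpace F H] [Group H]
  {j : H →* G}

theorem mfderiv_adRep_comp_apply (hj : ContMDiff 𝓘(ℝ, F) 𝓘(ℝ, E) 1 j) (w : F) (y : E) :
    (mfderiv 𝓘(ℝ, F) 𝓘(ℝ, E) (fun h => adRep (j h) y) 1 w : E) =
      @Bracket.bracket (GroupLieAlgebra 𝓘(ℝ, E) G) (GroupLieAlgebra 𝓘(ℝ, E) G) _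
        (mfderiv 𝓘(ℝ, F) 𝓘(ℝ, E) j 1 w : E) y :=
  (mfderiv_comp_apply_model (g := fun g : G => adRep g y) (f := j)
    ((contMDiff_adRep_apply y).mdifferentiable one_ne_zero 1)
    (hj.mdifferentiable one_ne_zero 1) (map_one j) w).trans
    (mfderiv_adRep_apply _ y)

/-- A function that is constant on the orbit of `y` under a group has vanishing derivative in the
directions of the tangent space of the orbit. -/
theorem fderiv_bracket_eq_zero (hj : ContMDiff 𝓘(ℝ, F) 𝓘(ℝ, E) 1 j)
    {f : GroupLieAlgebra 𝓘(ℝ, E) G → ℝ} {y : GroupLieAlgebra 𝓘(ℝ, E) G}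
    (hf : Differentiable ℝ (fun v : E => f v)) (hy : ∀ h, f (Ad (j h) y) = f y)
    {a : GroupLieAlgebra 𝓘(ℝ, E) G} (ha : ∃ w : F, (mfderiv 𝓘(ℝ, F) 𝓘(ℝ, E) j 1 w : E) = a) :
    fderiv ℝ f y ⁅a, y⁆ = 0 := by
  obtain ⟨w, rfl⟩ := ha
  have hd : ∀ v : E, MDifferentiable 𝓘(ℝ, F) 𝓘(ℝ, E) fun h => adRep (j h) v := fun v =>
    ((contMDiff_adRep_apply v).comp hj).mdifferentiable one_ne_zero
  have hone : ∀ v : E, adRep (j 1) v = v := fun v => by rw [map_one, map_one]; rfl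
  have h1 := fderiv_mfderiv_eq_zero (hf y) (hd y 1) (hone y) hy w
  exact (congrArg (fderiv ℝ (fun v : E => f v) y) (mfderiv_adRep_comp_apply hj w y)).symm.trans h1

theorem fderiv_bilinForm_self (β : LinearMap.BilinForm ℝ E) (y v : E) :
    DifferentiableAt ℝ (fun v => β v v) y ∧
      fderiv ℝ (fun v => β v v) y v = β y v + β v y := by
  have h : HasFDerivAt (fun v => β v v) _ y :=
    (LinearMap.toContinuousBilinearMap β).hasFDerivAt_of_bilinear (hasFDerivAt_id y)
      (hasFDerivAt_id y)
  exact ⟨h.differentiableAt, by rw [h.fderiv]; rfl⟩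

namespace ScalarProduct

variable (B : ScalarProduct (GroupLieAlgebra 𝓘(ℝ, E) G))

/-- The squared norm is constant on adjoint orbits, so its derivative in the orbit direction `⁅a,
y⁆` vanishes. Polarizing gives skewness of ad. -/
theorem form_bracket_self
    (hB : ∀ (g : G) (x y : GroupLieAlgebra 𝓘(ℝ, E) G), B.form (Ad g x) (Ad g y) = B.form x y)
    (a y : GroupLieAlgebra 𝓘(ℝ, E) G) : B.form y ⁅a, y⁆ = 0 := by
  have h := fderiv_bracket_eq_zero (j := MonoidHom.id G) (f := fun v => B.form v v) (y := y)
    (a := a) contMDiff_id (fun y => (fderiv_bilinForm_self (E := E) B.form y y).1) (fun h => hB h y y)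
    ⟨a, congrArg (fun D : E →L[ℝ] E => D a) mfderiv_id⟩
  have h2 : B.form y ⁅a, y⁆ + B.form ⁅a, y⁆ y = 0 :=
    (fderiv_bilinForm_self (E := E) B.form y _).2.symm.trans h
  rw [B.symm ⁅a, y⁆ y] at h2
  linarith

theorem form_bracket_left
    (hB : ∀ (g : G) (x y : GroupLieAlgebra 𝓘(ℝ, E) G), B.form (Ad g x) (Ad g y) = B.form x y)
    (a x y : GroupLieAlgebra 𝓘(ℝ, E) G) : B.form ⁅a, x⁆ y = -B.form x ⁅a, y⁆ := by
  have h := B.form_bracket_self hB a (x + y)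
  rw [lie_add, map_add, map_add, LinearMap.add_apply, LinearMap.add_apply,
    B.form_bracket_self hB, B.form_bracket_self hB, B.symm y] at h
  linarith

end ScalarProduct

end AdjointInvariance

/-! ### Gradients of invariants at generic points -/

section GenericInvariants

variable {E : Type*} [NormedAddCommGroup E] [NormedSpace ℝ E] [FiniteDimensional ℝ E]
  {G : Type*} [TopologicalSpace G] [ChartedSpace E G] [Group G] [LieGroup 𝓘(ℝ, E) ∞ G]
  {F : Type*} [NormedAddCommGroup F] [NormedSpace ℝ F]
  {H : Type*} [TopologicalSpace H] [ChartedSpace F H] [Group H] {j : H →* G}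
  {𝔥 : Submodule ℝ (GroupLieAlgebra 𝓘(ℝ, E) G)}

namespace ScalarProduct

variable {B : ScalarProduct (GroupLieAlgebra 𝓘(ℝ, E) G)}

/-- By skewness of ad, being Λ_x-orthogonal to 𝔥 is the same as being normal, for the scalar
product, to the tangent space [𝔥, x] of the orbit. -/
theorem mem_orthogonal_poissonTensor_iff
    (hB : ∀ (g : G) (x y : GroupLieAlgebra 𝓘(ℝ, E) G), B.form (Ad g x) (Ad g y) = B.form x y)
    {x v : GroupLieAlgebra 𝓘(ℝ, E) G} :
    v ∈ (B.poissonTensor x).orthogonal 𝔥 ↔ ∀ a ∈ 𝔥, B.form ⁅a, x⁆ v = 0 := by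
  refine forall₂_congr fun a _ => ?_
  rw [B.form_bracket_left hB]
  rfl

/-- Invariance is required only along the orbit of the one point `y`, so the bound also covers
functions that are invariant on a single adjoint orbit. -/
theorem gradSpan_le_orthogonal_poissonTensor
    (hB : ∀ (g : G) (x y : GroupLieAlgebra 𝓘(ℝ, E) G), B.form (Ad g x) (Ad g y) = B.form x y)
    (hj : ContMDiff 𝓘(ℝ, F) 𝓘(ℝ, E) 1 j)
    (h𝔥 : ∀ a, a ∈ 𝔥 ↔ ∃ w : F, (mfderiv 𝓘(ℝ, F) 𝓘(ℝ, E) j 1 w : E) = a)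
    {A : Set (GroupLieAlgebra 𝓘(ℝ, E) G → ℝ)} {y : GroupLieAlgebra 𝓘(ℝ, E) G}
    (hA : ∀ f ∈ A, Differentiable ℝ (fun v : E => f v) ∧ ∀ h, f (Ad (j h) y) = f y) :
    B.gradSpan A y ≤ (B.poissonTensor y).orthogonal 𝔥 := by
  rw [gradSpan, Submodule.span_le]
  rintro _ ⟨f, hf, rfl⟩
  refine (mem_orthogonal_poissonTensor_iff hB).2 fun a ha => ?_
  rw [B.symm, form_grad]
  exact fderiv_bracket_eq_zero hj (hA f hf).1 (hA f hf).2 ((h𝔥 a).1 ha)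

/-- At a generic point, the gradients of the polynomials invariant under a compact group span the
orthogonal complement of the tangent space of the orbit. -/
theorem exists_isOpen_dense_gradSpan_eq_orthogonal [FiniteDimensional ℝ F] [LieGroup 𝓘(ℝ, F) ∞ H]
    [CompactSpace H]
    (hB : ∀ (g : G) (x y : GroupLieAlgebra 𝓘(ℝ, E) G), B.form (Ad g x) (Ad g y) = B.form x y)
    (hj : ContMDiff 𝓘(ℝ, F) 𝓘(ℝ, E) 1 j)
    (h𝔥 : ∀ a, a ∈ 𝔥 ↔ ∃ w : F, (mfderiv 𝓘(ℝ, F) 𝓘(ℝ, E) j 1 w : E) = a)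
    {A : Set (GroupLieAlgebra 𝓘(ℝ, E) G → ℝ)}
    (hA : ∀ p, p ∈ A ↔ p ∈ polyFun (GroupLieAlgebra 𝓘(ℝ, E) G) ∧ ∀ h x, p (Ad (j h) x) = p x) :
    ∃ U : Set (GroupLieAlgebra 𝓘(ℝ, E) G), IsOpen U ∧ Dense U ∧
      ∀ x ∈ U, B.gradSpan A x = (B.poissonTensor x).orthogonal 𝔥 := by
  have hle : ∀ x, B.gradSpan A x ≤ (B.poissonTensor x).orthogonal 𝔥 :=
    fun x => gradSpan_le_orthogonal_poissonTensor hB hj h𝔥 fun f hf =>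
      ⟨(contDiff_of_mem_polyFun (V := E) ((hA f).1 hf).1).differentiable one_ne_zero,
        fun h => ((hA f).1 hf).2 h x⟩
  obtain ⟨U, r, hU, hUd, hUr⟩ : ∃ (U : Set (GroupLieAlgebra 𝓘(ℝ, E) G)) (r : ℕ), IsOpen U ∧
      Dense U ∧ ∀ x ∈ U, Module.finrank ℝ (B.gradSpan A x) = r :=
    exists_isOpen_dense_finrank_gradSpan_eq (V := E) B fun f hf => ((hA f).1 hf).1
  obtain ⟨U', t, hU', hUd', hUt⟩ : ∃ (U : Set (GroupLieAlgebra 𝓘(ℝ, E) G)) (t : ℕ), IsOpen U ∧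
      Dense U ∧ ∀ x ∈ U,
        Module.finrank ℝ (Submodule.span ℝ (Set.range fun a : 𝔥 =>
          ⁅(a : GroupLieAlgebra 𝓘(ℝ, E) G), x⁆)) = t :=
    exists_isOpen_dense_finrank_span_eq (V := E) _ fun a φ =>
      dual_mem_polyFun (V := E) (φ ∘ₗ (LieAlgebra.ad ℝ (GroupLieAlgebra 𝓘(ℝ, E) G) a :
        GroupLieAlgebra 𝓘(ℝ, E) G →ₗ[ℝ] GroupLieAlgebra 𝓘(ℝ, E) G))
  have horth : ∀ x, (B.poissonTensor x).orthogonal 𝔥 =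
      B.form.orthogonal (Submodule.span ℝ (Set.range fun a : 𝔥 =>
          ⁅(a : GroupLieAlgebra 𝓘(ℝ, E) G), x⁆)) := by
    intro x
    ext v
    rw [mem_orthogonal_poissonTensor_iff hB]
    constructor
    · intro h
      have : Submodule.span ℝ (Set.range fun a : 𝔥 => ⁅(a : GroupLieAlgebra 𝓘(ℝ, E) G), x⁆) ≤
          LinearMap.ker (B.form.flip v) := by
        rw [Submodule.span_le]
        rintro _ ⟨a, rfl⟩
        exact h a a.2
      exact fun u hu => this hu
    · exact fun h a ha => h _ (Submodule.subset_span ⟨⟨a, ha⟩, rfl⟩)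
  obtain ⟨y, ⟨hy, hy'⟩, hyA⟩ : ∃ y ∈ U ∩ U', ∀ v : GroupLieAlgebra 𝓘(ℝ, E) G,
      (∀ p ∈ A, fderiv ℝ p y v = 0) → ∃ a ∈ 𝔥, ⁅a, y⁆ = v := by
    obtain ⟨y, hy, h⟩ := exists_mem_forall_fderiv_eq_zero_imp (V := E) (F := F)
      (ρ := (adRep (E := E) (G := G)).comp j)
      (fun v => (contMDiff_adRep_apply (E := E) v).comp hj) (U := U ∩ U') (hU.inter hU')
      ((hUd.inter_of_isOpen_left hUd' hU).nonempty)
    refine ⟨y, hy, fun v hv => ?_⟩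
    obtain ⟨w, hw⟩ := h v fun p hp => hv p ((hA p).2 hp)
    exact ⟨_, (h𝔥 _).2 ⟨w, rfl⟩, (mfderiv_adRep_comp_apply hj w y).symm.trans hw⟩
  -- By taking orthogonals twice: a vector normal to all gradients of invariants at `y` is tangent
  -- to the orbit, hence orthogonal to `n`.
  have hyle : (B.poissonTensor y).orthogonal 𝔥 ≤ B.gradSpan A y := by
    intro n hn
    rw [mem_orthogonal_poissonTensor_iff hB] at hn
    rw [← LinearMap.BilinForm.orthogonal_orthogonal B.nondegenerate B.isRefl (B.gradSpan A y)]
    intro v hv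
    obtain ⟨a, ha, rfl⟩ := hyA v fun p hp => by
      rw [← B.form_grad]
      exact hv _ (B.grad_mem_gradSpan hp y)
    exact hn a ha
  -- Both dimensions are constant on `U ∩ U'`, so equality at the single point `y` propagates to all
  -- of it.
  have hrt : r = Module.finrank ℝ (GroupLieAlgebra 𝓘(ℝ, E) G) - t := by
    rw [← hUr y hy, le_antisymm (hle y) hyle, horth,
      LinearMap.BilinForm.finrank_orthogonal B.nondegenerate, hUt y hy']
  refine ⟨U ∩ U', hU.inter hU', hUd.inter_of_isOpen_left hUd' hU, fun x hx =>
    Submodule.eq_of_le_of_finrank_eq (hle x) ?_⟩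
  rw [hUr x hx.1, horth, LinearMap.BilinForm.finrank_orthogonal B.nondegenerate,
    hUt x hx.2, hrt]

end ScalarProduct

end GenericInvariants

/-! ### The dimension count -/

theorem proposition5p1
    {E : Type*} [NormedAddCommGroup E] [NormedSpace ℝ E] [FiniteDimensional ℝ E]
    {G : Type*} [TopologicalSpace G] [T2Space G] [ChartedSpace E G] [Group G]
    [LieGroup 𝓘(ℝ, E) ∞ G] [CompactSpace G] [ConnectedSpace G]
    {F : Type*} [NormedAddCommGroup F] [NormedSpace ℝ F] [FiniteDimensional ℝ F]
    (K : Subgroup G) [ChartedSpace F K] [LieGroup 𝓘(ℝ, F) ∞ K] [CompactSpace K] [ConnectedSpace K]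
    (hK : Manifold.IsSmoothEmbedding 𝓘(ℝ, F) 𝓘(ℝ, E) ∞ (Subtype.val : K → G))
    (B : ScalarProduct (GroupLieAlgebra 𝓘(ℝ, E) G))
    (hB : ∀ (g : G) (x y : GroupLieAlgebra 𝓘(ℝ, E) G),
      B.form (Ad g x) (Ad g y) = B.form x y)
    (hAMF : IsAlmostMultiplicityFree B K)
    (p : GroupLieAlgebra 𝓘(ℝ, E) G → ℝ) (hp : p ∈ invPoly K)
    (hind : B.IsIndependentFrom p
      ((invPoly (E := E) (⊤ : Subgroup G) : Set (GroupLieAlgebra 𝓘(ℝ, E) G → ℝ)) ∪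
        (B.liftedPoly (subgroupLieAlgebra F K) : Set (GroupLieAlgebra 𝓘(ℝ, E) G → ℝ)))) :
    IsCompleteCommutativeSetOfInvariants B F K
      (Algebra.adjoin ℝ
        ((invPoly (E := E) (⊤ : Subgroup G) : Set (GroupLieAlgebra 𝓘(ℝ, E) G → ℝ)) ∪ {p}) :
        Set (GroupLieAlgebra 𝓘(ℝ, E) G → ℝ)) := by
  set 𝔨 : Submodule ℝ (GroupLieAlgebra 𝓘(ℝ, E) G) := subgroupLieAlgebra F K
  set Z := (invPoly (E := E) (⊤ : Subgroup G) :
    Set (GroupLieAlgebra 𝓘(ℝ, E) G → ℝ))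
  set J := (invPoly (E := E) K : Set (GroupLieAlgebra 𝓘(ℝ, E) G → ℝ))
  set P := (B.liftedPoly 𝔨 : Set (GroupLieAlgebra 𝓘(ℝ, E) G → ℝ))
  have hZJ : Z ⊆ J := fun f hf => ⟨hf.1, fun k _ => hf.2 k trivial⟩
  have hS : (Algebra.adjoin ℝ (Z ∪ {p}) : Set (GroupLieAlgebra 𝓘(ℝ, E) G → ℝ)) ⊆ J :=
    Algebra.adjoin_le (Set.union_subset hZJ (Set.singleton_subset_iff.2 hp))
  have hJpoly : J ⊆ polyFun (GroupLieAlgebra 𝓘(ℝ, E) G) := fun f hf => hf.1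
  have hPpoly : P ⊆ polyFun (GroupLieAlgebra 𝓘(ℝ, E) G) := B.liftedPoly_le_polyFun 𝔨
  have hdiff : ∀ f ∈ polyFun (GroupLieAlgebra 𝓘(ℝ, E) G), ContDiff ℝ ∞ (fun v : E => f v) :=
    fun f hf => contDiff_of_mem_polyFun (V := E) hf
  have hadj : ∀ A : Set (GroupLieAlgebra 𝓘(ℝ, E) G → ℝ),
      A ⊆ polyFun (GroupLieAlgebra 𝓘(ℝ, E) G) → ∀ x,
      B.gradSpan (Algebra.adjoin ℝ A : Set (GroupLieAlgebra 𝓘(ℝ, E) G → ℝ)) x = B.gradSpan A x :=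
    fun A hA x => ScalarProduct.gradSpan_adjoin (V := E) B hA x
  have hgP : ∀ x, B.gradSpan P x = 𝔨 := fun x =>
    ScalarProduct.gradSpan_liftedPoly (V := E) B 𝔨 x
  have hgen : ∀ A : Set (GroupLieAlgebra 𝓘(ℝ, E) G → ℝ),
      A ⊆ polyFun (GroupLieAlgebra 𝓘(ℝ, E) G) →
      ∃ (U : Set (GroupLieAlgebra 𝓘(ℝ, E) G)) (r : ℕ), IsOpen U ∧ Dense U ∧
        ∀ x ∈ U, Module.finrank ℝ (B.gradSpan A x) = r :=
    fun A hA => ScalarProduct.exists_isOpen_dense_finrank_gradSpan_eq (V := E) B hA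
  have hjK : ContMDiff 𝓘(ℝ, F) 𝓘(ℝ, E) 1 K.subtype := hK.contMDiff.of_le (by simp)
  have hjG : ContMDiff 𝓘(ℝ, E) 𝓘(ℝ, E) 1 (MonoidHom.id G) := contMDiff_id
  have h𝔨mem : ∀ a, a ∈ 𝔨 ↔ ∃ w : F, (mfderiv 𝓘(ℝ, F) 𝓘(ℝ, E) K.subtype 1 w : E) = a :=
    fun a => Iff.rfl
  have h𝔤mem : ∀ a, a ∈ (⊤ : Submodule ℝ (GroupLieAlgebra 𝓘(ℝ, E) G)) ↔
      ∃ w : E, (mfderiv 𝓘(ℝ, E) 𝓘(ℝ, E) (MonoidHom.id G) 1 w : E) = a :=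
    fun a => ⟨fun _ => ⟨a, congrArg (fun D : E →L[ℝ] E => D a) mfderiv_id⟩, fun _ => trivial⟩
  have hZle : ∀ x, B.gradSpan Z x ≤ (B.poissonTensor x).orthogonal ⊤ := fun x =>
    ScalarProduct.gradSpan_le_orthogonal_poissonTensor hB hjG h𝔤mem fun f hf =>
      ⟨(hdiff f hf.1).differentiable (by simp), fun h => hf.2 h trivial x⟩
  have hJle : ∀ x, B.gradSpan J x ≤ (B.poissonTensor x).orthogonal 𝔨 := fun x =>
    ScalarProduct.gradSpan_le_orthogonal_poissonTensor hB hjK h𝔨mem fun f hf =>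
      ⟨(hdiff f hf.1).differentiable (by simp), fun h => hf.2 h h.2 x⟩
  obtain ⟨UZ, hUZ, hUZd, hUZeq⟩ : ∃ U : Set (GroupLieAlgebra 𝓘(ℝ, E) G), IsOpen U ∧ Dense U ∧
      ∀ x ∈ U, B.gradSpan Z x = (B.poissonTensor x).orthogonal ⊤ :=
    ScalarProduct.exists_isOpen_dense_gradSpan_eq_orthogonal hB hjG h𝔤mem fun f =>
      and_congr_right fun _ => ⟨fun h k x => h k trivial x, fun h k _ x => h k x⟩
  obtain ⟨UJ, hUJ, hUJd, hUJeq⟩ : ∃ U : Set (GroupLieAlgebra 𝓘(ℝ, E) G), IsOpen U ∧ Dense U ∧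
      ∀ x ∈ U, B.gradSpan J x = (B.poissonTensor x).orthogonal 𝔨 :=
    ScalarProduct.exists_isOpen_dense_gradSpan_eq_orthogonal hB hjK h𝔨mem fun f =>
      and_congr_right fun _ => ⟨fun h k x => h k k.2 x, fun h k hk x => h ⟨k, hk⟩ x⟩
  obtain ⟨U₁, r₁, hU₁, hUd₁, hr₁⟩ := hgen Z (hZJ.trans hJpoly)
  obtain ⟨U₂, r₂, hU₂, hUd₂, hr₂⟩ := hgen (Z ∪ P) (Set.union_subset (hZJ.trans hJpoly) hPpoly)
  obtain ⟨U₃, r₃, hU₃, hUd₃, hr₃⟩ := hgen (J ∪ P) (Set.union_subset hJpoly hPpoly)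
  obtain ⟨Up, hUp, hUpd, hpU⟩ := hind
  set U := UZ ∩ (UJ ∩ (U₁ ∩ (U₂ ∩ (U₃ ∩ Up)))) 
  have hU : IsOpen U := hUZ.inter (hUJ.inter (hU₁.inter (hU₂.inter (hU₃.inter hUp))))
  have hUd : Dense U := hUZd.inter_of_isOpen_left (hUJd.inter_of_isOpen_left
    (hUd₁.inter_of_isOpen_left (hUd₂.inter_of_isOpen_left (hUd₃.inter_of_isOpen_left hUpd hU₃)
      hU₂) hU₁) hUJ) hUZ
  have hrefl := B.isRefl_poissonTensor
  -- With Z the radical and N the orthogonal of 𝔨, the generic dimensions of Z, Z + 𝔨 and N + 𝔨 are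
  -- `r₁`, `r₂`, `r₃`. Those of N and N ∩ (Z + 𝔨) follow; the latter uses that Z lies in N.
  have hdim : ∀ x ∈ U,
      Module.finrank ℝ ((B.poissonTensor x).orthogonal ⊤) = r₁ ∧
      Module.finrank ℝ ↥((B.poissonTensor x).orthogonal ⊤ ⊔ 𝔨) = r₂ ∧
      Module.finrank ℝ ((B.poissonTensor x).orthogonal 𝔨) + r₂ =
        Module.finrank ℝ (GroupLieAlgebra 𝓘(ℝ, E) G) + r₁ ∧
      Module.finrank ℝ ↥((B.poissonTensor x).orthogonal 𝔨 ⊓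
        ((B.poissonTensor x).orthogonal ⊤ ⊔ 𝔨)) + r₃ =
        Module.finrank ℝ (GroupLieAlgebra 𝓘(ℝ, E) G) + r₁ := by
    rintro x ⟨hxZ, hxJ, hx₁, hx₂, hx₃, -⟩
    have h1 := hr₁ x hx₁
    have h2 := hr₂ x hx₂
    have h3 := hr₃ x hx₃
    rw [B.gradSpan_union, hgP, hUZeq x hxZ] at h2
    rw [B.gradSpan_union, hgP, hUJeq x hxJ] at h3
    rw [hUZeq x hxZ] at h1
    have h4 := (hrefl x).finrank_sup_add_finrank_orthogonal 𝔨
    have h5 := Submodule.finrank_sup_add_finrank_inf_eq ((B.poissonTensor x).orthogonal 𝔨)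
      ((B.poissonTensor x).orthogonal ⊤ ⊔ 𝔨)
    rw [← sup_assoc, sup_eq_left.2 (LinearMap.BilinForm.orthogonal_top_le 𝔨)] at h5
    omega
  have hr : r₃ = r₂ + 2 := by
    obtain ⟨UA, hUA, hUAd, hcompl⟩ := hAMF
    obtain ⟨x, hxA, hxU⟩ := (hUAd.inter_of_isOpen_left hUd hUA).nonempty
    obtain ⟨V, d, i, hV, hcl, hdi, hdim'⟩ := hcompl x hxA
    have hxO : x ∈ adOrbit x := ⟨1, congrArg (fun D : GroupLieAlgebra 𝓘(ℝ, E) G →L[ℝ]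
      GroupLieAlgebra 𝓘(ℝ, E) G => D x) Ad_one⟩
    -- The genericity on the orbit and the genericity in 𝔤 meet: `x` is in the closure of the good
    -- part of its orbit, and `U` is an open neighbourhood of `x`.
    obtain ⟨y, hyU, hyV⟩ := mem_closure_iff.1 (hcl hxO) U hU hxU
    obtain ⟨h1, h2, h3, h4⟩ := hdim y hyU
    -- The orbit invariants are squeezed: their gradients lie in N, and they include the invariant
    -- polynomials, whose gradients already span N.
    have hI : B.gradSpan (orbitInvariants K (adOrbit x)) y = (B.poissonTensor y).orthogonal 𝔨 := by
      refine le_antisymm ?_ ?_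
      · exact ScalarProduct.gradSpan_le_orthogonal_poissonTensor hB hjK h𝔨mem fun f hf =>
          ⟨hf.1.differentiable (by simp), fun h => hf.2 h h.2 y hyV.2⟩
      · rw [← hUJeq y hyU.2.1]
        exact B.gradSpan_mono (show J ⊆ orbitInvariants K (adOrbit x) from
          fun f hf => ⟨hdiff f hf.1, fun k hk y _ => hf.2 k hk y⟩) y
    obtain ⟨h5, h6⟩ := hdim' y hyV
    have hker : B.kerOn y ((B.poissonTensor y).orthogonal 𝔨) =
        (B.poissonTensor y).orthogonal 𝔨 ⊓ ((B.poissonTensor y).orthogonal ⊤ ⊔ 𝔨) :=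
      congrArg (_ ⊓ ·) ((hrefl y).orthogonal_orthogonal_eq_sup 𝔨)
    rw [hI] at h5 h6
    rw [hker] at h6
    have hz : B.kerOn y ⊤ = (B.poissonTensor y).orthogonal ⊤ := B.kerOn_top y
    -- Both spaces contain the radical, so passing to the quotient subtracts `r₁` from each, and d −
    -- i = 2 becomes `r₃ = r₂ + 2`.
    have h7 := finrank_map_mkQ_add_finrank (Z := B.kerOn y ⊤)
      (S := (B.poissonTensor y).orthogonal 𝔨)
      (hz.trans_le (LinearMap.BilinForm.orthogonal_top_le 𝔨))
    have h8 := finrank_map_mkQ_add_finrank (Z := B.kerOn y ⊤)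
      (S := (B.poissonTensor y).orthogonal 𝔨 ⊓ ((B.poissonTensor y).orthogonal ⊤ ⊔ 𝔨))
      (hz.trans_le (le_inf (LinearMap.BilinForm.orthogonal_top_le 𝔨) le_sup_left))
    have h9 : Module.finrank ℝ (B.kerOn y ⊤) = r₁ := hz ▸ h1
    rw [toOrbitCotangent] at h5 h6
    omega
  -- Each `+ 1` is the contribution of ∇p. The truncated subtraction is harmless: it computes dim(N
  -- ∩ (Z + 𝔨)), as recorded in `hdim`.
  refine ⟨hS, ?_, U, r₂ + 1,
    Module.finrank ℝ (GroupLieAlgebra 𝓘(ℝ, E) G) + r₁ - r₃ + 1, hU, hUd, fun x hx => ?_⟩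
  · intro f hf g hg x
    have hmem : ∀ f ∈ (Algebra.adjoin ℝ (Z ∪ {p}) : Set (GroupLieAlgebra 𝓘(ℝ, E) G → ℝ)),
        B.grad f x ∈ (B.poissonTensor x).orthogonal ⊤ ⊔ Submodule.span ℝ {B.grad p x} := by
      intro f hf
      have h := B.grad_mem_gradSpan hf x
      rw [hadj _ ((Algebra.subset_adjoin.trans hS).trans hJpoly), B.gradSpan_union,
        B.gradSpan_singleton] at h
      exact sup_le_sup_right (hZle x) _ h
    obtain ⟨a, ha, b, hb, hab⟩ := Submodule.mem_sup.1 (hmem f hf)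
    obtain ⟨c, hc, d, hd, hcd⟩ := Submodule.mem_sup.1 (hmem g hg)
    obtain ⟨s, rfl⟩ := Submodule.mem_span_singleton.1 hb
    obtain ⟨t, rfl⟩ := Submodule.mem_span_singleton.1 hd
    -- The radical components drop out on either side, leaving only a multiple of Λ_x(∇p, ∇p), which
    -- is zero.
    have h1 : ∀ u, B.poissonTensor x u c = 0 := fun u => hc u trivial
    have h2 : ∀ u, B.poissonTensor x a u = 0 := fun u => hrefl x _ _ (ha u trivial)
    rw [ScalarProduct.poissonBracket, ← hab, ← hcd, map_add, h1, map_smul, map_add,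
      LinearMap.add_apply, h2, map_smul, LinearMap.smul_apply, B.poissonTensor_self]
    simp
  · obtain ⟨h1, h2, h3, h4⟩ := hdim x hx
    have hspan : B.gradSpan ((Submodule.span ℝ (Algebra.adjoin ℝ (Z ∪ {p}) :
          Set (GroupLieAlgebra 𝓘(ℝ, E) G → ℝ)) ⊔ B.liftedPoly 𝔨 :
          Submodule ℝ (GroupLieAlgebra 𝓘(ℝ, E) G → ℝ)) : Set (GroupLieAlgebra 𝓘(ℝ, E) G → ℝ)) x =
        ((B.poissonTensor x).orthogonal ⊤ ⊔ 𝔨) ⊔ Submodule.span ℝ {B.grad p x} := by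
      have hpoly : (Z ∪ {p}) ∪ P ⊆ polyFun (GroupLieAlgebra 𝓘(ℝ, E) G) :=
        Set.union_subset ((Algebra.subset_adjoin.trans hS).trans hJpoly) hPpoly
      have h5 : B.gradSpan ((Z ∪ {p}) ∪ P) x =
          ((B.poissonTensor x).orthogonal ⊤ ⊔ 𝔨) ⊔ Submodule.span ℝ {B.grad p x} := by
        rw [B.gradSpan_union, B.gradSpan_union, B.gradSpan_singleton, hgP, hUZeq x hx.1,
          sup_right_comm]
      rw [← h5]
      refine le_antisymm ?_ (B.gradSpan_mono (Set.union_subset ?_ ?_) x)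
      · rw [← hadj _ hpoly]
        refine B.gradSpan_mono (show (_ : Submodule ℝ (GroupLieAlgebra 𝓘(ℝ, E) G → ℝ)) ≤
          Subalgebra.toSubmodule (Algebra.adjoin ℝ ((Z ∪ {p}) ∪ P)) from
          sup_le (Submodule.span_le.2 ?_) ?_) x
        · exact Algebra.adjoin_mono Set.subset_union_left
        · exact Set.subset_union_right.trans Algebra.subset_adjoin
      · exact fun f hf => Submodule.mem_sup_left
          (Submodule.subset_span (Algebra.subset_adjoin hf))
      · exact fun f hf => Submodule.mem_sup_right hf
    have hpN : B.grad p x ∈ (B.poissonTensor x).orthogonal 𝔨 :=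
      hJle x (B.grad_mem_gradSpan hp x)
    have hpW : B.grad p x ∉ (B.poissonTensor x).orthogonal ⊤ ⊔ 𝔨 := by
      have := hpU x hx.2.2.2.2.2
      rwa [B.gradSpan_union, hgP, hUZeq x hx.1] at this
    obtain ⟨h5, h6⟩ := (hrefl x).finrank_sup_span_singleton hpN (B.poissonTensor_self x _) hpW
    rw [hspan, B.kerOn_top, ScalarProduct.kerOn]
    omega
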